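/- **Theorem.** Let $\tau>0$, and let $\mathcal C=C([-\tau,0],\mathbb R^n)$ carry the supremum norm $\|\phi\|_\tau$; for a continuous function $x$ write $x_t(s)=x(t+s)$, $s\in[-\tau,0]$. Let $f:[0,\infty)\times\mathcal C\times\mathbb R^m\to\mathbb R^n$ be measurable in $t$ with $f(t,0,0)=0$ for all $t\ge 0$, and let $k:\mathbb R^n\to\mathbb R^m$ with $k(0)=0$. (Solutions of differential equations are understood in integrated form; this is the classical notion if $f$ is continuous in $t$.) Assume that there are functions $\alpha_1,\alpha_2,\alpha_3\in\mathcal K_\infty$ and $\chi\in\mathcal K$, a constant $\mu>0$, a function $V_1:[0,\infty)\times\mathbb R^n\to[0,\infty)$ such that $t\mapsto V_1(t,x(t))$ is continuous for every continuous $x:[0,\infty)\to\mathbb R^n$, and a functional $V_2:[0,\infty)\times\mathcal C\to[0,\infty)$, locally Lipschitz in its second argument, such that $t\mapsto V_2(t,x_t)$ is continuous on $[0,\infty)$ for every continuous $x:[-\tau,\infty)\to\mathbb R^n$, with the following properties for all $t\ge0$ and $\phi\in\mathcal C$. (i) $\alpha_1(\|\phi(0)\|)\le V_1(t,\phi(0))\le\alpha_2(\|\phi(0)\|)$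 and $0\le V_2(t,\phi)\le\alpha_3(\|\phi\|_\tau)$. (ii) With $V(t,\phi)=V_1(t,\phi(0))+V_2(t,\phi)$ and for every $z\in\mathbb R^n$, the upper right-hand Dini derivative $\mathrm D^+V(t,\phi)=\limsup_{h\to0^+}\frac{V(t+h,x_{t+h})-V(t,\phi)}{h}$ along the solution of $\dot x(s)=f(s,x_s,k(z))$, $s\ge t$, $x_t=\phi$, satisfies $\mathrm D^+V(t,\phi)\le-\mu V(t,\phi)+\chi(\|\epsilon\|)$, where $\epsilon=z-\phi(0)$ is the sampling error. Assume moreover: (iii) $\alpha_1^{-1}$, $\chi$ (both on $[0,\infty)$) and $k$ are locally Lipschitz. (iv) $f$ is locally Lipschitz in its second and in its third argument, that is, for all $S,R>0$ there is an $L$ such that for all $t\in[0,S]$, $\|\phi\|_\tau,\|\psi\|_\tau\le R$ and $\|u\|,\|v\|\le R$ one has $\|f(t,\phi,u)-f(t,\psi,u)\|\le L\|\phi-\psi\|_\tau$ and $\|f(t,\phi,u)-f(t,\phi,v)\|\le L\|u-v\|$. Let $0\le\sigma<\mu$, $a>0$, $b>0$ and $t_0\ge0$. For $\varphi\in\mathcal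 C$ consider the event-triggered closed-loop system $$\dot x(t)=f\big(t,x_t,k(x(t_i))\big)\ \text{ for } t\in[t_i,t_{i+1}),\qquad x_{t_0}=\varphi,$$ with the event times $$t_{i+1}=\inf\Big\{t\ge t_i:\ \chi(\|x(t_i)-x(t)\|)=\sigma\,\alpha_1(\|x(t)\|)+\chi\big(a e^{-b(t-t_0)}\big)\Big\},\qquad i=0,1,2,\dots$$ ($\inf\emptyset=\infty$, in which case no further event occurs). Then this system is globally asymptotically stable: for every $\varphi\in\mathcal C$ there is a unique solution and it exists on $[t_0,\infty)$; for every $\varepsilon>0$ there is a $\delta>0$ such that $\|\varphi\|_\tau<\delta$ implies $\|x(t)\|<\varepsilon$ for all $t\ge t_0$; and $x(t)\to0$ as $t\to\infty$ for every $\varphi\in\mathcal C$. Moreover it has no Zeno behavior: no solution, on whatever interval $[t_0,T)$ with $t_0<T\le\infty$ it is defined, has infinitely many event times in a bounded time interval. -/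

import Mathlib

open Set Filter Topology MeasureTheory
open scoped NNReal

namespace DelayETC

noncomputable section

/-- Euclidean space of dimension `n`. -/
abbrev Vec (n : ℕ) : Type := EuclideanSpace ℝ (Fin n)

/-- The space of continuous functions from `[-τ, 0]` to `ℝⁿ`; since `[-τ, 0]` is compact, its norm
is the supremum norm. -/
abbrev Hist (τ : ℝ) (n : ℕ) : Type := C(Icc (-τ) (0 : ℝ), Vec n)

/-- Class `𝒦` (only the values on `[0, ∞)` matter). -/
structure ClassK (α : ℝ → ℝ) : Prop where
  continuousOn : ContinuousOn α (Ici 0)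
  strictMonoOn : StrictMonoOn α (Ici 0)
  map_zero : α 0 = 0

/-- Class `𝒦_∞`. -/
structure ClassKInf (α : ℝ → ℝ) : Prop extends ClassK α where
  tendsto_atTop : Tendsto α atTop atTop

/-- The inverse on `[0, ∞)` of a function of class `𝒦_∞`. -/
def invK (α : ℝ → ℝ) : ℝ → ℝ := Function.invFunOn α (Ici 0)

open Classical in
/-- The segment `x_t`, `x_t(s) = x(t + s)` for `s ∈ [-τ, 0]`, of a function that is continuous on
`[t - τ, t]` (and `0` otherwise, which is never used). -/
def hist {n : ℕ} (τ : ℝ) (x : ℝ → Vec n) (t : ℝ) : Hist τ n :=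
  if h : ContinuousOn x (Icc (t - τ) t) then
    ⟨fun s => x (t + s), h.comp_continuous (continuous_const.add continuous_subtype_val)
      fun s => ⟨by linarith [s.2.1], by linarith [s.2.2]⟩⟩
  else 0

/-- The upper right-hand Dini derivative of `g` at `t`, as an extended real number. -/
def diniUpper (g : ℝ → ℝ) (t : ℝ) : EReal :=
  limsup (fun h : ℝ => (((g (t + h) - g t) / h : ℝ) : EReal)) (𝓝[>] 0)

/-- Class `𝒱₀`. -/
structure ClassV0 {n : ℕ} (V : ℝ → Vec n → ℝ) : Prop where
  nonneg : ∀ t, 0 ≤ t → ∀ y, 0 ≤ V t y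
  continuousOn : ∀ x : ℝ → Vec n, ContinuousOn x (Ici 0) →
    ContinuousOn (fun t => V t (x t)) (Ici 0)

/-- Class `𝒱₀*`. -/
structure ClassV0Star {n : ℕ} (τ : ℝ) (V : ℝ → Hist τ n → ℝ) : Prop where
  nonneg : ∀ t, 0 ≤ t → ∀ φ, 0 ≤ V t φ
  continuousOn : ∀ x : ℝ → Vec n, ContinuousOn x (Ici (-τ)) →
    ContinuousOn (fun t => V t (hist τ x t)) (Ici 0)
  locallyLipschitz : ∀ t, 0 ≤ t → LocallyLipschitz (V t)

/-- The vector field `f` is Lipschitz on bounded sets in its second argument and in its third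
argument, locally uniformly in the time and uniformly for the other argument in bounded sets. -/
def LocLipField {n m : ℕ} {τ : ℝ} (f : ℝ → Hist τ n → Vec m → Vec n) : Prop :=
  ∀ S R : ℝ, ∃ L : ℝ, ∀ t, 0 ≤ t → t ≤ S →
    (∀ (φ ψ : Hist τ n) (u : Vec m), ‖φ‖ ≤ R → ‖ψ‖ ≤ R → ‖u‖ ≤ R →
      ‖f t φ u - f t ψ u‖ ≤ L * ‖φ - ψ‖) ∧
    (∀ (φ : Hist τ n) (u v : Vec m), ‖φ‖ ≤ R → ‖u‖ ≤ R → ‖v‖ ≤ R →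
      ‖f t φ u - f t φ v‖ ≤ L * ‖u - v‖)

/-- On `[c, s]` the function `x` satisfies `x'(r) = f(r, x_r, u)` with the constant input `u`, in
integrated form at the end point `s`. If the right-hand side is continuous in `r`, then the
validity for all `s` in an interval `[c, d)` is the validity of the differential equation there. -/
def HeldEq {n m : ℕ} {τ : ℝ} (f : ℝ → Hist τ n → Vec m → Vec n) (x : ℝ → Vec n) (u : Vec m)
    (c s : ℝ) : Prop :=
  IntervalIntegrable (fun r => f r (hist τ x r) u) volume c s ∧
    x s = x c + ∫ r in c..s, f r (hist τ x r) u

/-- The functional `V(t, x_t) = V₁(t, x(t)) + V₂(t, x_t)` along a function `x`. -/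
def lyap {n : ℕ} {τ : ℝ} (V₁ : ℝ → Vec n → ℝ) (V₂ : ℝ → Hist τ n → ℝ) (x : ℝ → Vec n) (t : ℝ) :
    ℝ :=
  V₁ t (x t) + V₂ t (hist τ x t)

/-- The standing Lyapunov conditions (i) and (ii). In (ii), `x` runs through all local solutions
that start at the time `t` from an arbitrary `φ = x_t`, under the held input `u = k(z)` with an
arbitrary sampled state `z`; the sampling error at the time `t` is `z - x(t)`. -/
structure LyapunovConditions {n m : ℕ} {τ : ℝ} (f : ℝ → Hist τ n → Vec m → Vec n)
    (k : Vec n → Vec m) (V₁ : ℝ → Vec n → ℝ) (V₂ : ℝ → Hist τ n → ℝ) (α₁ α₂ α₃ χ : ℝ → ℝ)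
    (μ : ℝ) : Prop where
  classV0 : ClassV0 V₁
  classV0Star : ClassV0Star τ V₂
  classK_one : ClassKInf α₁
  classK_two : ClassKInf α₂
  classK_three : ClassKInf α₃
  classK_chi : ClassK χ
  mu_pos : 0 < μ
  bounds_one : ∀ t, 0 ≤ t → ∀ y : Vec n, α₁ ‖y‖ ≤ V₁ t y ∧ V₁ t y ≤ α₂ ‖y‖
  bounds_two : ∀ t, 0 ≤ t → ∀ φ : Hist τ n, 0 ≤ V₂ t φ ∧ V₂ t φ ≤ α₃ ‖φ‖
  dini_le : ∀ t h : ℝ, 0 ≤ t → 0 < h → ∀ (x : ℝ → Vec n) (z : Vec n),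
    ContinuousOn x (Ico (t - τ) (t + h)) →
    (∀ s ∈ Ico t (t + h), HeldEq f x (k z) t s) →
    diniUpper (lyap V₁ V₂ x) t ≤ ((-μ * lyap V₁ V₂ x t + χ ‖z - x t‖ : ℝ) : EReal)

/-- `x` is a solution on `[t₀, T)` of the event-triggered closed-loop system with the initial
function `φ`, and `t 0, t 1, …` are its event times (in `[t₀, T)`). Times are extended
real numbers: `T = ⊤` means that `x` is defined for all times, and `t i = ⊤` means that the `i`-th
event does not occur before `T` (the infimum of the empty set is `⊤`). -/
structure IsClosedLoopSolution {n m : ℕ} {τ : ℝ} (f : ℝ → Hist τ n → Vec m → Vec n)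
    (k : Vec n → Vec m) (α₁ χ : ℝ → ℝ) (σ a b t₀ : ℝ) (φ : Hist τ n)
    (T : EReal) (x : ℝ → Vec n) (t : ℕ → EReal) : Prop where
  lt_end : (t₀ : EReal) < T
  init : ∀ s : Icc (-τ) (0 : ℝ), x (t₀ + s) = φ s
  continuousOn : ContinuousOn x {s : ℝ | t₀ - τ ≤ s ∧ (s : EReal) < T}
  event_zero : t 0 = t₀
  event_succ : ∀ i, t (i + 1) = sInf {s : EReal | ∃ r : ℝ, s = r ∧ t i ≤ r ∧ (r : EReal) < T ∧
    χ ‖x (t i).toReal - x r‖ = σ * α₁ ‖x r‖ + χ (a * Real.exp (-b * (r - t₀)))}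
  cover : ∀ s : ℝ, t₀ ≤ s → (s : EReal) < T → ∃ i, t i ≤ s ∧ (s : EReal) < t (i + 1)
  dynamics : ∀ (i : ℕ) (s : ℝ), t i ≤ s → (s : EReal) < t (i + 1) → (s : EReal) < T →
    HeldEq f x (k (x (t i).toReal)) (t i).toReal s

/-- Global asymptotic stability of the zero solution for a system with initial time `t₀`, given
through the relation `Sol φ T x t` that `x` is a solution on `[t₀, T)` with the initial function
`φ` (and the event times `t`): every initial function has a solution on `[t₀, ∞)`, unique among
all solutions on intervals `[t₀, T)`; the zero solution is stable; and it is globally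
attractive. -/
structure GloballyAsymptoticallyStable {n : ℕ} {τ : ℝ} (t₀ : ℝ)
    (Sol : Hist τ n → EReal → (ℝ → Vec n) → (ℕ → EReal) → Prop) : Prop where
  wellPosed : ∀ φ, ∃ x t, Sol φ ⊤ x t ∧
    ∀ T y s, Sol φ T y s → ∀ r : ℝ, t₀ - τ ≤ r → (r : EReal) < T → y r = x r
  stable : ∀ ε : ℝ, 0 < ε → ∃ δ : ℝ, 0 < δ ∧ ∀ φ, ‖φ‖ < δ → ∀ x t, Sol φ ⊤ x t →
    ∀ r, t₀ ≤ r → ‖x r‖ < ε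
  attractive : ∀ φ x t, Sol φ ⊤ x t → Tendsto x atTop (𝓝 0)

/-- Absence of Zeno behavior: no solution, on whatever interval `[t₀, T)` it is defined, has
infinitely many events in a bounded time interval. -/
def NoZeno {n : ℕ} {τ : ℝ} (Sol : Hist τ n → EReal → (ℝ → Vec n) → (ℕ → EReal) → Prop) : Prop :=
  ∀ φ T x t, Sol φ T x t → ∀ S : ℝ, {i : ℕ | t i ≤ (S : EReal)}.Finite

end

end DelayETC

/-!
Stability cannot be read off from the Lyapunov functional alone, because the threshold
`χ (a e^{-b (t - t₀)})` of the triggering rule does not vanish with the initial function. The argument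
has four parts.

*Decay.* Between events the triggering rule gives `χ(‖ε‖) ≤ σ α₁(‖x‖) + χ(a e^{-b (t - t₀)})`, and
`σ α₁(‖x‖) ≤ σ V`. Condition (ii) therefore yields `D⁺V ≤ -(μ - σ) V + χ(a e^{-b (c - t₀)})` from any
time `c` on, and a comparison principle (`le_of_diniUpper_le`) gives exponential decay of `V` up to
`χ(a e^{-b (c - t₀)}) / (μ - σ)` (`LyapunovConditions.decay`). Taking `c = t₀` this bounds all solutions
(`exists_norm_le`); letting `c → ∞` it gives attractivity.

*No Zeno behavior.* On a bounded time interval a solution is bounded, so its velocity is bounded, whereas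
between two events the state has to move by at least the threshold `a e^{-b (t - t₀)}`, which is bounded
below there. Thus the time between events is bounded below (`noZeno`).

*Well-posedness.* If the arguments of `f` and `k` are clipped radially at a radius `R`, the field
becomes globally Lipschitz and bounded on bounded time intervals. Picard iteration solves the equation
under held inputs globally (`exists_volterra_solution`, `exists_heldEq`), and concatenation over the
events gives a global closed-loop solution (`exists_closedLoopSolution`). For `R` above the a priori
bound, the decay estimate, applied up to the first time at which the norm `R` would be reached, shows
that the solution never gets there, so that the clipping is not felt (`exists_global_solution`).
Uniqueness follows by induction over the events from uniqueness under held inputs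
(`eqOn_of_heldEq`, `IsClosedLoopSolution.unique`).

*Stability.* Choose `S` so late that the threshold is negligible from `S` on. As `f(t, 0, 0) = 0` and
`k(0) = 0`, a Gronwall argument keeps the solution small before the first event
(`IsClosedLoopSolution.norm_le_exp`), too small to reach the threshold before `S`. Hence for a small initial
function there is no event in `[t₀, S]`, the solution is small there, and the decay estimate started at
`S` keeps it small afterwards (`exists_delta_stable`).
-/

namespace DelayETC

/-! ### Volterra equations in exponentially weighted norms -/

theorem integral_exp_weight (K P c s : ℝ) :
    ∫ r in c..s, K * (P * Real.exp (2 * K * (r - c))) =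
      P / 2 * (Real.exp (2 * K * (s - c)) - 1) := by
  have hd : ∀ r ∈ uIcc c s, HasDerivAt (fun r => P / 2 * Real.exp (2 * K * (r - c)))
      (K * (P * Real.exp (2 * K * (r - c)))) r := by
    intro r _
    have h1 : HasDerivAt (fun r : ℝ => 2 * K * (r - c)) (2 * K) r := by
      simpa using ((hasDerivAt_id r).sub_const c).const_mul (2 * K)
    exact (h1.exp.const_mul (P / 2)).congr_deriv (by ring)
  rw [intervalIntegral.integral_eq_sub_of_hasDerivAt hd]
  · simp; ring
  · exact Continuous.intervalIntegrable (by fun_prop) _ _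

/-- Integration against the weight `exp (2 K (r - c))` halves the constant: this is the contraction
estimate behind Picard iteration, uniqueness and continuous dependence. -/
theorem norm_integral_le_exp_weight {E : Type*} [NormedAddCommGroup E] [NormedSpace ℝ E]
    {N : ℝ → E} {K P c s : ℝ} (hcs : c ≤ s)
    (h : ∀ r ∈ Ioc c s, ‖N r‖ ≤ K * (P * Real.exp (2 * K * (r - c)))) :
    ‖∫ r in c..s, N r‖ ≤ P / 2 * (Real.exp (2 * K * (s - c)) - 1) := by
  rw [← integral_exp_weight]
  exact intervalIntegral.norm_integral_le_of_norm_le hcs (Eventually.of_forall h)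
    (Continuous.intervalIntegrable (by fun_prop) _ _)

/-- A Gronwall inequality in bootstrap form, suited to equations with memory: the assumption says
that an exponential bound on the whole interval reproduces itself with half the constant. -/
theorem gronwall_bootstrap {d : ℝ → ℝ} {c S K δ : ℝ} (hd : ContinuousOn d (Icc c S))
    (hδ : 0 ≤ δ)
    (h : ∀ P, δ ≤ P → (∀ q ∈ Icc c S, d q ≤ P * Real.exp (K * (q - c))) →
      ∀ q ∈ Icc c S, d q ≤ δ + P / 2 * Real.exp (K * (q - c)))
    (hK : 0 ≤ K) {s : ℝ} (hs : s ∈ Icc c S) : d s ≤ 2 * δ * Real.exp (K * (s - c)) := by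
  have hcont : ContinuousOn (fun q => d q * Real.exp (-(K * (q - c)))) (Icc c S) :=
    hd.mul (by fun_prop)
  obtain ⟨q₀, hq₀, hmax⟩ := isCompact_Icc.exists_isMaxOn ⟨s, hs⟩ hcont
  have hexp : ∀ q, Real.exp (-(K * (q - c))) * Real.exp (K * (q - c)) = 1 := fun q => by
    rw [← Real.exp_add]; simp
  set P₀ := d q₀ * Real.exp (-(K * (q₀ - c))) with hP₀
  have hle : ∀ q ∈ Icc c S, d q ≤ P₀ * Real.exp (K * (q - c)) := by
    intro q hq
    have h1 : d q * Real.exp (-(K * (q - c))) ≤ P₀ := hmax hq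
    calc d q = d q * Real.exp (-(K * (q - c))) * Real.exp (K * (q - c)) := by
          rw [mul_assoc, hexp, mul_one]
      _ ≤ _ := mul_le_mul_of_nonneg_right h1 (Real.exp_pos _).le
  -- At the maximum point `q₀`, the bootstrap gives `P₀ ≤ δ + P₀ / 2`.
  have hP : P₀ ≤ 2 * δ := by
    by_contra! hlt
    have hδP : δ ≤ P₀ := by linarith
    have h2 := h P₀ hδP hle q₀ hq₀
    have hone : Real.exp (-(K * (q₀ - c))) ≤ 1 :=
      Real.exp_le_one_iff.2 (neg_nonpos.2 (mul_nonneg hK (by linarith [hq₀.1])))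
    have h3 := mul_le_mul_of_nonneg_right h2 (Real.exp_pos (-(K * (q₀ - c)))).le
    have h4 : δ * Real.exp (-(K * (q₀ - c))) ≤ δ := mul_le_of_le_one_right hδ hone
    have h5 : (δ + P₀ / 2 * Real.exp (K * (q₀ - c))) * Real.exp (-(K * (q₀ - c))) =
        δ * Real.exp (-(K * (q₀ - c))) + P₀ / 2 := by
      linear_combination (P₀ / 2) * hexp q₀
    linarith
  exact (hle s hs).trans (mul_le_mul_of_nonneg_right hP (Real.exp_pos _).le)

/-- Global solvability of a Volterra equation `x(s) = y(c) + ∫_c^s N(x)(r) dr` with prescribed past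
`x = y` on `(-∞, c]`, by Picard iteration: in the norms weighted by `exp (2 L (q - c))` the iteration
contracts with factor `1 / 2`. -/
theorem exists_volterra_solution {E : Type*} [NormedAddCommGroup E] [NormedSpace ℝ E]
    [CompleteSpace E] (c : ℝ) (y : C(ℝ, E)) (N : C(ℝ, E) → ℝ → E)
    (hint : ∀ x a b, IntervalIntegrable (N x) volume a b)
    (hlip : ∀ S, ∃ L, 0 < L ∧ ∀ r ∈ Icc c S, ∀ (x x' : C(ℝ, E)) (B : ℝ), 0 ≤ B →
      (∀ q ≤ r, ‖x q - x' q‖ ≤ B) → ‖N x r - N x' r‖ ≤ L * B) :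
    ∃ x : C(ℝ, E), (∀ q ≤ c, x q = y q) ∧ ∀ s, c ≤ s → x s = y c + ∫ r in c..s, N x r := by
  -- `min` and `max` make the Picard operator act on functions on the whole line.
  let Φ : C(ℝ, E) → C(ℝ, E) := fun x =>
    ⟨fun s => y (min s c) + ∫ r in c..max s c, N x r,
      (y.continuous.comp (by fun_prop)).add
        ((intervalIntegral.continuous_primitive (hint x) c).comp (by fun_prop))⟩
  have hΦ_le : ∀ x, ∀ q ≤ c, Φ x q = y q := by
    intro x q hq
    simp [Φ, hq]
  have hΦ_ge : ∀ x, ∀ s, c ≤ s → Φ x s = y c + ∫ r in c..s, N x r := by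
    intro x s hs
    simp [Φ, hs]
  let X : ℕ → C(ℝ, E) := fun j => Φ^[j] (Φ y)
  have hXs : ∀ j, X (j + 1) = Φ (X j) := fun j => Function.iterate_succ_apply' _ _ _
  have hX_le : ∀ j, ∀ q ≤ c, X j q = y q := by
    intro j q hq
    cases j with
    | zero => exact hΦ_le _ q hq
    | succ j => rw [hXs]; exact hΦ_le _ q hq
  -- The successive differences decay geometrically, uniformly on `(-∞, S]`.
  have hgeo : ∀ S, c ≤ S → ∃ M, ∀ j, ∀ q ≤ S, dist (X j q) (X (j + 1) q) ≤ M * (1 / 2) ^ j := by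
    intro S hS
    obtain ⟨L, hL, hN⟩ := hlip S
    obtain ⟨M, hM⟩ := isCompact_Icc.exists_bound_of_continuousOn
      (s := Icc c S) (f := fun q => X 0 q - X 1 q) (by fun_prop)
    have hM0 : 0 ≤ M := (norm_nonneg _).trans (hM c ⟨le_rfl, hS⟩)
    have key : ∀ j, ∀ q ∈ Icc c S,
        ‖X j q - X (j + 1) q‖ ≤ M * (1 / 2) ^ j * Real.exp (2 * L * (q - c)) := by
      intro j
      induction j with
      | zero =>
        intro q hq
        have h1 : 1 ≤ Real.exp (2 * L * (q - c)) :=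
          Real.one_le_exp (mul_nonneg (by linarith) (by linarith [hq.1]))
        have := hM q hq
        simp only [pow_zero, mul_one]
        nlinarith
      | succ j ih =>
        intro q hq
        have hP0 : 0 ≤ M * (1 / 2) ^ j := by positivity
        rw [hXs, hXs (j + 1), hΦ_ge _ q hq.1, hΦ_ge _ q hq.1, add_sub_add_left_eq_sub,
          ← intervalIntegral.integral_sub (hint _ _ _) (hint _ _ _)]
        refine (norm_integral_le_exp_weight (K := L) (P := M * (1 / 2) ^ j) hq.1 ?_).trans ?_
        · intro r hr
          refine hN r ⟨hr.1.le, hr.2.trans hq.2⟩ _ _ _ (by positivity) ?_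
          intro p hp
          rcases le_total p c with hpc | hpc
          · rw [hX_le j p hpc, hX_le (j + 1) p hpc, sub_self, norm_zero]
            positivity
          · refine (ih p ⟨hpc, hp.trans (hr.2.trans hq.2)⟩).trans ?_
            gcongr
        · rw [pow_succ]
          nlinarith
    refine ⟨M * Real.exp (2 * L * (S - c)), fun j q hq => ?_⟩
    rcases le_total q c with hqc | hqc
    · rw [hX_le j q hqc, hX_le (j + 1) q hqc, dist_self]
      positivity
    · rw [dist_eq_norm]
      refine (key j q ⟨hqc, hq⟩).trans ?_
      rw [mul_right_comm]
      gcongr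
  have hlim : ∀ q, ∃ z, Tendsto (fun j => X j q) atTop (𝓝 z) := by
    intro q
    obtain ⟨M, hM⟩ := hgeo (max q c) (le_max_right _ _)
    exact cauchySeq_tendsto_of_complete
      (cauchySeq_of_le_geometric (1 / 2) M (by norm_num) fun j => hM j q (le_max_left _ _))
  choose x hx using hlim
  have hdist : ∀ S, c ≤ S → ∃ M, ∀ j, ∀ q ≤ S, dist (X j q) (x q) ≤ M * (1 / 2) ^ j := by
    intro S hS
    obtain ⟨M, hM⟩ := hgeo S hS
    refine ⟨2 * M, fun j q hq => ?_⟩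
    have := dist_le_of_le_geometric_of_tendsto (1 / 2) M (by norm_num) (fun j => hM j q hq) (hx q) j
    refine this.trans (le_of_eq ?_)
    ring
  have hpow : ∀ M : ℝ, Tendsto (fun j : ℕ => M * (1 / 2) ^ j) atTop (𝓝 0) := fun M => by
    simpa using (tendsto_pow_atTop_nhds_zero_of_lt_one (r := (1 / 2 : ℝ)) (by norm_num)
      (by norm_num)).const_mul M
  have hxc : Continuous x := by
    rw [continuous_iff_continuousAt]
    intro q
    set S := max (q + 1) c
    obtain ⟨M, hM⟩ := hdist S (le_max_right _ _)
    have hu : TendstoUniformlyOn (fun j p => X j p) x atTop (Iic S) := by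
      rw [Metric.tendstoUniformlyOn_iff]
      intro ε hε
      filter_upwards [(hpow M).eventually_lt_const hε] with j hj p hp
      rw [dist_comm]
      exact (hM j p hp).trans_lt hj
    exact (hu.continuousOn (Frequently.of_forall fun j => (X j).continuous.continuousOn)).continuousAt
      (Iic_mem_nhds (lt_of_lt_of_le (lt_add_one q) (le_max_left _ _)))
  refine ⟨⟨x, hxc⟩, fun q hq => ?_, fun s hs => ?_⟩
  · exact tendsto_nhds_unique (hx q) ((tendsto_congr fun j => hX_le j q hq).2 tendsto_const_nhds)
  · obtain ⟨M, hM⟩ := hdist s hs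
    obtain ⟨L, hL, hN⟩ := hlip s
    have h1 : Tendsto (fun j => X (j + 1) s) atTop (𝓝 (x s)) := (hx s).comp (tendsto_add_atTop_nat 1)
    refine tendsto_nhds_unique h1 ?_
    rw [tendsto_iff_norm_sub_tendsto_zero]
    refine squeeze_zero (fun _ => norm_nonneg _) (fun j => ?_) (hpow (L * M * (s - c)))
    rw [hXs, hΦ_ge _ s hs, add_sub_add_left_eq_sub,
      ← intervalIntegral.integral_sub (hint _ _ _) (hint _ _ _)]
    refine (intervalIntegral.norm_integral_le_of_norm_le_const (C := L * (M * (1 / 2) ^ j))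
      fun r hr => ?_).trans (le_of_eq ?_)
    · rw [uIoc_of_le hs] at hr
      refine hN r ⟨hr.1.le, hr.2⟩ _ _ _ (dist_nonneg.trans (hM j s le_rfl)) fun q hq => ?_
      rw [← dist_eq_norm]
      exact hM j q (hq.trans hr.2)
    · rw [abs_of_nonneg (by linarith)]
      ring

/-! ### Segments and held inputs -/

section Hist
variable {n m : ℕ} {τ : ℝ}

theorem hist_apply {x : ℝ → Vec n} {t : ℝ} (hx : ContinuousOn x (Icc (t - τ) t))
    (s : Icc (-τ) (0 : ℝ)) : hist τ x t s = x (t + s) := by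
  simp [hist, hx]

theorem hist_congr {x y : ℝ → Vec n} {t : ℝ} (h : EqOn x y (Icc (t - τ) t)) :
    hist τ x t = hist τ y t := by
  by_cases hx : ContinuousOn x (Icc (t - τ) t)
  · have hy : ContinuousOn y (Icc (t - τ) t) := hx.congr h.symm
    ext1 s
    rw [hist_apply hx, hist_apply hy]
    exact h ⟨by linarith [s.2.1], by linarith [s.2.2]⟩
  · have hy : ¬ ContinuousOn y (Icc (t - τ) t) := fun hy => hx (hy.congr h)
    simp [hist, hx, hy]

theorem norm_hist_le {x : ℝ → Vec n} {t B : ℝ} (hB : 0 ≤ B)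
    (h : ∀ q ∈ Icc (t - τ) t, ‖x q‖ ≤ B) : ‖hist τ x t‖ ≤ B := by
  by_cases hx : ContinuousOn x (Icc (t - τ) t)
  · refine (ContinuousMap.norm_le _ hB).2 fun s => ?_
    rw [hist_apply hx]
    exact h _ ⟨by linarith [s.2.1], by linarith [s.2.2]⟩
  · simpa [hist, hx] using hB

theorem norm_hist_sub_hist_le {x y : ℝ → Vec n} {t B : ℝ} (hB : 0 ≤ B)
    (hx : ContinuousOn x (Icc (t - τ) t)) (hy : ContinuousOn y (Icc (t - τ) t))
    (h : ∀ q ∈ Icc (t - τ) t, ‖x q - y q‖ ≤ B) : ‖hist τ x t - hist τ y t‖ ≤ B := by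
  refine (ContinuousMap.norm_le _ hB).2 fun s => ?_
  rw [ContinuousMap.sub_apply, hist_apply hx, hist_apply hy]
  exact h _ ⟨by linarith [s.2.1], by linarith [s.2.2]⟩

theorem continuous_hist (τ : ℝ) {x : ℝ → Vec n} (hx : Continuous x) :
    Continuous (hist τ x) := by
  refine ContinuousMap.continuous_of_continuous_uncurry _ ?_
  have : (Function.uncurry fun (t : ℝ) (s : Icc (-τ) (0 : ℝ)) => hist τ x t s) =
      fun p => x (p.1 + p.2) := by
    ext1 p
    exact hist_apply hx.continuousOn p.2
  rw [this]
  fun_prop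

/-- A function that is continuous on a compact interval agrees there with a function that is
continuous on the whole line. -/
theorem exists_continuous_eqOn_Icc {E : Type*} [TopologicalSpace E] {x : ℝ → E} {p q : ℝ}
    (hpq : p ≤ q) (hx : ContinuousOn x (Icc p q)) : ∃ y : C(ℝ, E), EqOn y x (Icc p q) :=
  ⟨⟨IccExtend hpq ((Icc p q).domRestrict x),
    (continuousOn_iff_continuous_domRestrict.1 hx).Icc_extend'⟩,
    fun _ hr => IccExtend_of_mem hpq ((Icc p q).domRestrict x) hr⟩

theorem HeldEq.congr {f : ℝ → Hist τ n → Vec m → Vec n} {x y : ℝ → Vec n} {u : Vec m} {c s : ℝ}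
    (hτ : 0 ≤ τ) (hcs : c ≤ s) (hxy : EqOn x y (Icc (c - τ) s)) (h : HeldEq f x u c s) :
    HeldEq f y u c s := by
  have hf : EqOn (fun r => f r (hist τ x r) u) (fun r => f r (hist τ y r) u) (Icc c s) := by
    intro r hr
    have : hist τ x r = hist τ y r :=
      hist_congr (hxy.mono (Icc_subset_Icc (by linarith [hr.1]) hr.2))
    simp only [this]
  refine ⟨h.1.congr (hf.mono (by rw [uIoc_of_le hcs]; exact Ioc_subset_Icc_self)), ?_⟩
  rw [← hxy ⟨by linarith, le_rfl⟩, ← hxy ⟨by linarith, hcs⟩, h.2]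
  congr 1
  exact intervalIntegral.integral_congr (by rwa [uIcc_of_le hcs])

/-- The field and the input matter only along the solution. -/
theorem HeldEq.congr_field {f g : ℝ → Hist τ n → Vec m → Vec n} {x : ℝ → Vec n} {u v : Vec m}
    {c s : ℝ} (hcs : c ≤ s) (h : HeldEq f x u c s)
    (hfg : ∀ r ∈ Icc c s, f r (hist τ x r) u = g r (hist τ x r) v) : HeldEq g x v c s := by
  have hf : EqOn (fun r => f r (hist τ x r) u) (fun r => g r (hist τ x r) v) (Icc c s) := hfg
  refine ⟨h.1.congr (hf.mono (by rw [uIoc_of_le hcs]; exact Ioc_subset_Icc_self)), ?_⟩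
  rw [h.2]
  congr 1
  exact intervalIntegral.integral_congr (by rwa [uIcc_of_le hcs])

theorem HeldEq.sub {f : ℝ → Hist τ n → Vec m → Vec n} {x : ℝ → Vec n} {u : Vec m} {c r s : ℝ}
    (hr : HeldEq f x u c r) (hs : HeldEq f x u c s) : HeldEq f x u r s := by
  refine ⟨hr.1.symm.trans hs.1, ?_⟩
  rw [hs.2, hr.2, add_assoc, intervalIntegral.integral_add_adjacent_intervals hr.1
    (hr.1.symm.trans hs.1)]

theorem HeldEq.norm_sub_le {f : ℝ → Hist τ n → Vec m → Vec n} {x : ℝ → Vec n} {u : Vec m}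
    {c s F : ℝ} (hcs : c ≤ s) (h : HeldEq f x u c s)
    (hF : ∀ r ∈ Icc c s, ‖f r (hist τ x r) u‖ ≤ F) : ‖x c - x s‖ ≤ F * (s - c) := by
  rw [h.2, sub_add_cancel_left, norm_neg]
  refine (intervalIntegral.norm_integral_le_of_norm_le_const (C := F) fun r hr => ?_).trans ?_
  · rw [uIoc_of_le hcs] at hr
    exact hF r (Ioc_subset_Icc_self hr)
  · rw [abs_of_nonneg (by linarith)]

theorem LocLipField.exists_pos {f : ℝ → Hist τ n → Vec m → Vec n} (hf : LocLipField f) (S R : ℝ) :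
    ∃ L : ℝ, 0 < L ∧ ∀ t, 0 ≤ t → t ≤ S →
    (∀ (φ ψ : Hist τ n) (u : Vec m), ‖φ‖ ≤ R → ‖ψ‖ ≤ R → ‖u‖ ≤ R →
      ‖f t φ u - f t ψ u‖ ≤ L * ‖φ - ψ‖) ∧
    (∀ (φ : Hist τ n) (u v : Vec m), ‖φ‖ ≤ R → ‖u‖ ≤ R → ‖v‖ ≤ R →
      ‖f t φ u - f t φ v‖ ≤ L * ‖u - v‖) := by
  obtain ⟨L, hL⟩ := hf S R
  refine ⟨max L 1, by positivity, fun t h0 hS => ⟨fun φ ψ u h1 h2 h3 => ?_,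
    fun φ u v h1 h2 h3 => ?_⟩⟩
  · exact ((hL t h0 hS).1 φ ψ u h1 h2 h3).trans
      (mul_le_mul_of_nonneg_right (le_max_left _ _) (norm_nonneg _))
  · exact ((hL t h0 hS).2 φ u v h1 h2 h3).trans
      (mul_le_mul_of_nonneg_right (le_max_left _ _) (norm_nonneg _))

theorem LocLipField.exists_linear_bound {f : ℝ → Hist τ n → Vec m → Vec n} (hf : LocLipField f)
    (hf_zero : ∀ t, 0 ≤ t → f t 0 0 = 0) (S R : ℝ) :
    ∃ L : ℝ, 0 < L ∧ ∀ t, 0 ≤ t → t ≤ S → ∀ (φ : Hist τ n) (u : Vec m), ‖φ‖ ≤ R → ‖u‖ ≤ R →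
      ‖f t φ u‖ ≤ L * (‖φ‖ + ‖u‖) := by
  obtain ⟨L, hL, h⟩ := hf.exists_pos S R
  refine ⟨L, hL, fun t h0 hS φ u hφ hu => ?_⟩
  have hR : 0 ≤ R := (norm_nonneg _).trans hφ
  have h1 := (h t h0 hS).1 φ 0 u hφ (by simpa using hR) hu
  have h2 := (h t h0 hS).2 0 u 0 (by simpa using hR) hu (by simpa using hR)
  rw [hf_zero t h0, sub_zero, sub_zero] at h2
  rw [sub_zero] at h1
  calc ‖f t φ u‖ = ‖(f t φ u - f t 0 u) + f t 0 u‖ := by rw [sub_add_cancel]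
    _ ≤ L * ‖φ‖ + L * ‖u‖ := (norm_add_le _ _).trans (add_le_add h1 h2)
    _ = _ := by ring

/-- Two solutions under the same held input with the same past coincide. -/
theorem eqOn_of_heldEq {f : ℝ → Hist τ n → Vec m → Vec n} (hτ : 0 ≤ τ) (hf : LocLipField f)
    {x y : ℝ → Vec n} {u : Vec m} {c s : ℝ} (hc : 0 ≤ c) (hcs : c ≤ s)
    (hx : ContinuousOn x (Icc (c - τ) s)) (hy : ContinuousOn y (Icc (c - τ) s))
    (hpast : EqOn x y (Icc (c - τ) c))
    (hxu : ∀ r ∈ Icc c s, HeldEq f x u c r) (hyu : ∀ r ∈ Icc c s, HeldEq f y u c r) :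
    x s = y s := by
  obtain ⟨A, hA⟩ := isCompact_Icc.exists_bound_of_continuousOn hx
  obtain ⟨B, hB⟩ := isCompact_Icc.exists_bound_of_continuousOn hy
  have hmem : c ∈ Icc (c - τ) s := ⟨by linarith, hcs⟩
  have hA0 : 0 ≤ A := (norm_nonneg _).trans (hA c hmem)
  have hB0 : 0 ≤ B := (norm_nonneg _).trans (hB c hmem)
  set R := max (max A B) ‖u‖
  have hAR : A ≤ R := (le_max_left _ _).trans (le_max_left _ _)
  have hBR : B ≤ R := (le_max_right _ _).trans (le_max_left _ _)
  obtain ⟨L, hL, hlip⟩ := hf.exists_pos s R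
  have hd := gronwall_bootstrap (d := fun q => ‖x q - y q‖) (c := c) (S := s) (K := 2 * L) (δ := 0)
    ((hx.sub hy).norm.mono (Icc_subset_Icc (by linarith) le_rfl)) le_rfl ?_ (by positivity)
    (s := s) ⟨hcs, le_rfl⟩
  · rw [mul_zero, zero_mul] at hd
    exact sub_eq_zero.1 (norm_le_zero_iff.1 hd)
  · intro P hP hb q hq
    rw [(hxu q hq).2, (hyu q hq).2, hpast ⟨by linarith, le_rfl⟩, add_sub_add_left_eq_sub,
      ← intervalIntegral.integral_sub (hxu q hq).1 (hyu q hq).1]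
    refine (norm_integral_le_exp_weight (K := L) (P := P) hq.1 fun r hr => ?_).trans (by linarith)
    have hrs : r ≤ s := hr.2.trans hq.2
    have hsub : Icc (r - τ) r ⊆ Icc (c - τ) s := Icc_subset_Icc (by linarith [hr.1]) hrs
    refine ((hlip r (by linarith [hr.1]) hrs).1 _ _ u
      (norm_hist_le (hA0.trans hAR) fun p hp => (hA p (hsub hp)).trans hAR)
      (norm_hist_le (hA0.trans hAR) fun p hp => (hB p (hsub hp)).trans hBR)
      (le_max_right _ _)).trans ?_
    refine mul_le_mul_of_nonneg_left ?_ hL.le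
    refine norm_hist_sub_hist_le (by positivity) (hx.mono hsub) (hy.mono hsub) fun p hp => ?_
    rcases le_total p c with hpc | hpc
    · rw [hpast ⟨by linarith [hp.1, hr.1], hpc⟩, sub_self, norm_zero]
      positivity
    · refine (hb p ⟨hpc, hp.2.trans hrs⟩).trans ?_
      have := hp.2
      gcongr

end Hist

/-! ### First zeros and unbounded sequences -/

section EventTime

/-- A real sequence whose steps are bounded below by a positive constant is unbounded. -/
theorem not_forall_le_of_steps {s : ℕ → ℝ} {η F S : ℝ} (hη : 0 < η) (hs : ∀ i, s 0 ≤ s i)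
    (hstep : ∀ i, η ≤ F * (s (i + 1) - s i)) : ¬ ∀ i, s i ≤ S := by
  intro hS
  have hsum : ∀ j : ℕ, j * η ≤ F * (s j - s 0) := by
    intro j
    induction j with
    | zero => simp
    | succ j ih => push_cast; linarith [hstep j]
  obtain ⟨j, hj⟩ := exists_nat_gt (|F| * (S - s 0) / η)
  rw [div_lt_iff₀ hη] at hj
  have h1 : F * (s j - s 0) ≤ |F| * (S - s 0) :=
    mul_le_mul (le_abs_self F) (by linarith [hS j]) (by linarith [hs j]) (abs_nonneg F)
  linarith [hsum j]

/-- The first zero after `c` and before `T` of a continuous function that is negative at `c`, as an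
extended real number: it comes after `c`, it is attained if it is finite, and the function is
negative before it. -/
theorem sInf_zero_spec {G : ℝ → ℝ} {c : ℝ} {T e : EReal}
    (hG : ContinuousOn G {r : ℝ | c ≤ r ∧ (r : EReal) < T}) (hGc : G c < 0)
    (he : e = sInf {s : EReal | ∃ r : ℝ, s = r ∧ (c : EReal) ≤ r ∧ (r : EReal) < T ∧ G r = 0}) :
    (c : EReal) < e ∧ (∀ r : ℝ, c ≤ r → (r : EReal) < T → (r : EReal) < e → G r < 0) ∧
      (e ≠ ⊤ → ∃ r : ℝ, e = r ∧ c < r ∧ (r : EReal) < T ∧ G r = 0) := by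
  have hatt : e ≠ ⊤ → ∃ r : ℝ, e = r ∧ c < r ∧ (r : EReal) < T ∧ G r = 0 := by
    intro htop
    have hne : ∃ r₁ : ℝ, c ≤ r₁ ∧ (r₁ : EReal) < T ∧ G r₁ = 0 := by
      by_contra! hno
      apply htop
      rw [he, sInf_eq_top]
      rintro _ ⟨r, rfl, h1, h2, h3⟩
      exact absurd h3 (hno r (EReal.coe_le_coe_iff.1 h1) h2)
    obtain ⟨r₁, hc1, hT1, hG1⟩ := hne
    have hcl : IsClosed (Icc c r₁ ∩ G ⁻¹' {0}) :=
      (hG.mono fun r hr =>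
        ⟨hr.1, (EReal.coe_le_coe_iff.2 hr.2).trans_lt hT1⟩).preimage_isClosed_of_isClosed isClosed_Icc isClosed_singleton
    obtain ⟨r₀, hr₀, hmin⟩ := (isCompact_Icc.of_isClosed_subset hcl inter_subset_left).exists_isLeast
      ⟨r₁, ⟨hc1, le_rfl⟩, hG1⟩
    have hT0 : (r₀ : EReal) < T := (EReal.coe_le_coe_iff.2 hr₀.1.2).trans_lt hT1
    refine ⟨r₀, ?_, lt_of_le_of_ne hr₀.1.1 ?_, hT0, hr₀.2⟩
    · rw [he]
      refine le_antisymm (sInf_le ⟨r₀, rfl, EReal.coe_le_coe_iff.2 hr₀.1.1, hT0, hr₀.2⟩) ?_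
      refine le_sInf ?_
      rintro _ ⟨r, rfl, h1, h2, h3⟩
      rw [EReal.coe_le_coe_iff] at h1 ⊢
      rcases le_total r r₁ with hr | hr
      · exact hmin ⟨⟨h1, hr⟩, h3⟩
      · exact hr₀.1.2.trans hr
    · rintro rfl
      exact hGc.ne hr₀.2
  refine ⟨?_, ?_, hatt⟩
  · by_cases htop : e = ⊤
    · rw [htop]
      exact EReal.coe_lt_top c
    · obtain ⟨r, hr, hcr, -⟩ := hatt htop
      rw [hr]
      exact EReal.coe_lt_coe_iff.2 hcr
  · intro r hcr hrT hre
    by_contra! hpos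
    have hGr : ContinuousOn G (Icc c r) :=
      hG.mono fun q hq => ⟨hq.1, (EReal.coe_le_coe_iff.2 hq.2).trans_lt hrT⟩
    obtain ⟨q, hq, hq0⟩ := intermediate_value_Icc hcr hGr ⟨hGc.le, hpos⟩
    have : e ≤ q := by
      rw [he]
      exact sInf_le ⟨q, rfl, EReal.coe_le_coe_iff.2 hq.1,
        (EReal.coe_le_coe_iff.2 hq.2).trans_lt hrT, hq0⟩
    exact absurd hre (not_lt.2 (this.trans (EReal.coe_le_coe_iff.2 hq.2)))

end EventTime

/-! ### Comparison functions and event times -/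

section Events
variable {n : ℕ}

/-- The first time in `[c, T)` at which the triggering condition holds for the function `x` with the
sample `x(c)`, and `⊤` if there is none. -/
noncomputable def eventTime (α₁ χ : ℝ → ℝ) (σ a b t₀ : ℝ) (T : EReal) (x : ℝ → Vec n) (c : EReal) :
    EReal :=
  sInf {s : EReal | ∃ r : ℝ, s = r ∧ c ≤ r ∧ (r : EReal) < T ∧
    χ ‖x c.toReal - x r‖ = σ * α₁ ‖x r‖ + χ (a * Real.exp (-b * (r - t₀)))}

theorem ClassK.nonneg {α : ℝ → ℝ} (hα : ClassK α) {y : ℝ} (hy : 0 ≤ y) : 0 ≤ α y := by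
  rw [← hα.map_zero]
  exact hα.strictMonoOn.monotoneOn (mem_Ici.2 le_rfl) hy hy

theorem ClassK.pos {α : ℝ → ℝ} (hα : ClassK α) {y : ℝ} (hy : 0 < y) : 0 < α y := by
  rw [← hα.map_zero]
  exact hα.strictMonoOn (mem_Ici.2 le_rfl) hy.le hy

theorem ClassK.mono {α : ℝ → ℝ} (hα : ClassK α) {y z : ℝ} (hy : 0 ≤ y) (hyz : y ≤ z) :
    α y ≤ α z :=
  hα.strictMonoOn.monotoneOn hy (hy.trans hyz) hyz

theorem ClassK.le_of_map_le {α : ℝ → ℝ} (hα : ClassK α) {y z : ℝ} (hy : 0 ≤ y) (hz : 0 ≤ z)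
    (h : α y ≤ α z) : y ≤ z :=
  (hα.strictMonoOn.le_iff_le hy hz).1 h

/-- At the event, the sampling error is at least the threshold `a e^{-b(r - t₀)}`. -/
theorem threshold_le_of_event {α₁ χ : ℝ → ℝ} {σ a b t₀ : ℝ} (hα : ClassKInf α₁) (hχ : ClassK χ)
    (hσ : 0 ≤ σ) (ha : 0 < a) {y z : Vec n} {r : ℝ}
    (h : χ ‖z - y‖ = σ * α₁ ‖y‖ + χ (a * Real.exp (-b * (r - t₀)))) :
    a * Real.exp (-b * (r - t₀)) ≤ ‖z - y‖ := by
  refine hχ.le_of_map_le (by positivity) (norm_nonneg _) ?_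
  rw [h]
  have := mul_nonneg hσ (hα.toClassK.nonneg (norm_nonneg y))
  linarith

theorem eventTime_spec {α₁ χ : ℝ → ℝ} {σ a b t₀ : ℝ} (hα : ClassKInf α₁) (hχ : ClassK χ)
    (hσ : 0 ≤ σ) (ha : 0 < a) {x : ℝ → Vec n} {c : ℝ} {T : EReal}
    (hx : ContinuousOn x {r : ℝ | c ≤ r ∧ (r : EReal) < T}) :
    (c : EReal) < eventTime α₁ χ σ a b t₀ T x c ∧
      (∀ r : ℝ, c ≤ r → (r : EReal) < T → (r : EReal) < eventTime α₁ χ σ a b t₀ T x c →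
        χ ‖x c - x r‖ ≤ σ * α₁ ‖x r‖ + χ (a * Real.exp (-b * (r - t₀)))) ∧
      (eventTime α₁ χ σ a b t₀ T x c ≠ ⊤ →
        ∃ r : ℝ, eventTime α₁ χ σ a b t₀ T x c = r ∧ c < r ∧ (r : EReal) < T ∧
          χ ‖x c - x r‖ = σ * α₁ ‖x r‖ + χ (a * Real.exp (-b * (r - t₀)))) := by
  have hcomp : ∀ {α : ℝ → ℝ} {g : ℝ → ℝ} {s : Set ℝ}, ClassK α → ContinuousOn g s →
      (∀ r ∈ s, 0 ≤ g r) → ContinuousOn (fun r => α (g r)) s :=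
    fun h hg h0 => h.continuousOn.comp hg h0
  have hG : ContinuousOn (fun r => χ ‖x c - x r‖ -
      (σ * α₁ ‖x r‖ + χ (a * Real.exp (-b * (r - t₀))))) {r : ℝ | c ≤ r ∧ (r : EReal) < T} := by
    refine (hcomp hχ (continuousOn_const.sub hx).norm fun r _ => norm_nonneg _).sub
      ((continuousOn_const.mul (hcomp hα.toClassK hx.norm fun r _ => norm_nonneg _)).add
      (hcomp hχ (by fun_prop) fun r _ => by positivity))
  have hGc : χ ‖x c - x c‖ - (σ * α₁ ‖x c‖ + χ (a * Real.exp (-b * (c - t₀)))) < 0 := by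
    have h1 := mul_nonneg hσ (hα.toClassK.nonneg (norm_nonneg (x c)))
    have h2 : 0 < χ (a * Real.exp (-b * (c - t₀))) := hχ.pos (by positivity)
    rw [sub_self, norm_zero, hχ.map_zero]
    linarith
  have h := sInf_zero_spec (e := eventTime α₁ χ σ a b t₀ T x c) hG hGc (by
    simp only [eventTime, EReal.toReal_coe, sub_eq_zero])
  refine ⟨h.1, fun r h1 h2 h3 => by linarith [h.2.1 r h1 h2 h3], fun htop => ?_⟩
  obtain ⟨r, h1, h2, h3, h4⟩ := h.2.2 htop
  exact ⟨r, h1, h2, h3, sub_eq_zero.1 h4⟩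

theorem le_eventTime (α₁ χ : ℝ → ℝ) (σ a b t₀ : ℝ) (T : EReal) (x : ℝ → Vec n) (c : EReal) :
    c ≤ eventTime α₁ χ σ a b t₀ T x c := by
  refine le_sInf ?_
  rintro _ ⟨r, rfl, h, -⟩
  exact h

theorem eventTime_top (α₁ χ : ℝ → ℝ) (σ a b t₀ : ℝ) (T : EReal) (x : ℝ → Vec n) :
    eventTime α₁ χ σ a b t₀ T x ⊤ = ⊤ :=
  top_le_iff.1 (le_eventTime ..)

/-- The event time after `c` depends only on the values of the function up to that time. -/
theorem eventTime_congr {α₁ χ : ℝ → ℝ} {σ a b t₀ : ℝ} (hα : ClassKInf α₁) (hχ : ClassK χ)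
    (hσ : 0 ≤ σ) (ha : 0 < a) {x y : ℝ → Vec n} {c : ℝ} (hx : Continuous x)
    (hxy : ∀ r : ℝ, (r : EReal) ≤ eventTime α₁ χ σ a b t₀ ⊤ x c → x r = y r) :
    eventTime α₁ χ σ a b t₀ ⊤ y c = eventTime α₁ χ σ a b t₀ ⊤ x c := by
  have hspec := eventTime_spec (t₀ := t₀) (b := b) hα hχ hσ ha (c := c) (T := ⊤) hx.continuousOn
  have hc := hxy c hspec.1.le
  refine le_antisymm ?_ ?_
  · by_cases htop : eventTime α₁ χ σ a b t₀ ⊤ x c = ⊤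
    · rw [htop]
      exact le_top
    · obtain ⟨r, h1, h2, h3, h4⟩ := hspec.2.2 htop
      have hr := hxy r h1.ge
      rw [h1]
      refine sInf_le ⟨r, rfl, EReal.coe_le_coe_iff.2 h2.le, h3, ?_⟩
      rwa [EReal.toReal_coe, ← hc, ← hr]
  · refine le_sInf ?_
    rintro _ ⟨r, rfl, h1, h2, h3⟩
    by_contra! hlt
    refine absurd hlt (not_lt.2 (sInf_le ⟨r, rfl, h1, h2, ?_⟩))
    rw [EReal.toReal_coe] at h3 ⊢
    rwa [hc, hxy r hlt.le]

end Events

/-! ### Existence for globally Lipschitz fields -/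

section Existence
variable {n m : ℕ} {τ : ℝ}

/-- Global solvability of the delay differential equation under a held input, for a field that is
globally Lipschitz and bounded on bounded time intervals. -/
theorem exists_heldEq {f : ℝ → Hist τ n → Vec m → Vec n} {u : Vec m}
    (hmeas : ∀ φ, Measurable fun t : ℝ≥0 => f t φ u)
    (hlip : ∀ S, ∃ L, 0 < L ∧ ∀ t, 0 ≤ t → t ≤ S → ∀ φ ψ, ‖f t φ u - f t ψ u‖ ≤ L * ‖φ - ψ‖)
    (hbd : ∀ S, ∃ F, ∀ t, 0 ≤ t → t ≤ S → ∀ φ, ‖f t φ u‖ ≤ F)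
    {c : ℝ} (hc : 0 ≤ c) (y : C(ℝ, Vec n)) :
    ∃ x : C(ℝ, Vec n), (∀ q ≤ c, x q = y q) ∧ ∀ s, c ≤ s → HeldEq f x u c s := by
  -- The field is frozen before `c`, where nothing is known about it for negative times.
  have hint : ∀ (x : C(ℝ, Vec n)) (p q : ℝ), IntervalIntegrable
      (fun r => f (max r c) (hist τ x (max r c)) u) volume p q := by
    intro x p q
    have hm : Measurable (fun r : ℝ => f (max r c) (hist τ x (max r c)) u) := by
      have h1 : Measurable (Function.uncurry fun (q : ℝ) (t : ℝ≥0) => f t (hist τ x q) u) := by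
        refine measurable_uncurry_of_continuous_of_measurable (fun t => ?_) fun q => hmeas _
        obtain ⟨L, hL, h⟩ := hlip t
        have : LipschitzWith L.toNNReal fun φ => f t φ u := by
          refine LipschitzWith.of_dist_le_mul fun φ ψ => ?_
          rw [dist_eq_norm, dist_eq_norm, Real.coe_toNNReal L hL.le]
          exact h t t.2 le_rfl φ ψ
        exact this.continuous.comp (continuous_hist τ x.continuous)
      have h2 : Measurable fun r : ℝ => (max r c, (max r c).toNNReal) := by fun_prop
      convert h1.comp h2 using 2 with r
      simp [Function.uncurry, hc]
    obtain ⟨F, hF⟩ := hbd (max (max p q) c)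
    refine (intervalIntegrable_const (c := F)).mono_fun' hm.aestronglyMeasurable
      (ae_restrict_of_forall_mem measurableSet_uIoc fun r hr => ?_)
    refine hF _ (hc.trans (le_max_right _ _)) (max_le_max_right c ?_) _
    exact hr.2
  obtain ⟨x, hx, hxs⟩ := exists_volterra_solution c y
    (fun x r => f (max r c) (hist τ x (max r c)) u) hint (fun S => by
      obtain ⟨L, hL, h⟩ := hlip S
      refine ⟨L, hL, fun r hr x x' B hB hb => ?_⟩
      simp only [max_eq_left hr.1]
      refine (h r (hc.trans hr.1) hr.2 _ _).trans (mul_le_mul_of_nonneg_left ?_ hL.le)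
      exact norm_hist_sub_hist_le hB x.continuous.continuousOn x'.continuous.continuousOn
        fun q hq => hb q hq.2)
  refine ⟨x, hx, fun s hs => ?_⟩
  have heq : EqOn (fun r => f (max r c) (hist τ x (max r c)) u) (fun r => f r (hist τ x r) u)
      (Icc c s) := by
    intro r hr
    simp only [max_eq_left hr.1]
  refine ⟨(hint x c s).congr (heq.mono (by rw [uIoc_of_le hs]; exact Ioc_subset_Icc_self)), ?_⟩
  rw [hxs s hs, hx c le_rfl]
  congr 1
  exact intervalIntegral.integral_congr (by rwa [uIcc_of_le hs])

/-- A closed-loop solution on `[t₀, ∞)` for a field that is globally Lipschitz and bounded on bounded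
time intervals. The solution is the common extension of functions `Y i`, where `Y (i + 1)` follows
`Y i` until the event time `t (i + 1)` and holds the new sample forever after. -/
theorem exists_closedLoopSolution {f : ℝ → Hist τ n → Vec m → Vec n} {k : Vec n → Vec m}
    {α₁ χ : ℝ → ℝ} {σ a b t₀ : ℝ} (hτ : 0 ≤ τ) (hα : ClassKInf α₁) (hχ : ClassK χ)
    (hσ : 0 ≤ σ) (ha : 0 < a) (hb : 0 ≤ b) (ht₀ : 0 ≤ t₀)
    (hmeas : ∀ φ u, Measurable fun t : ℝ≥0 => f t φ u)
    (hlip : ∀ S z, ∃ L, 0 < L ∧ ∀ t, 0 ≤ t → t ≤ S → ∀ φ ψ,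
      ‖f t φ (k z) - f t ψ (k z)‖ ≤ L * ‖φ - ψ‖)
    (hbd : ∀ S, ∃ F, ∀ t, 0 ≤ t → t ≤ S → ∀ φ z, ‖f t φ (k z)‖ ≤ F) (φ : Hist τ n) :
    ∃ x t, IsClosedLoopSolution f k α₁ χ σ a b t₀ φ ⊤ x t ∧ Continuous x := by
  -- `H c y` follows `y` until `c` and holds the sample `y c` from then on.
  have hheld : ∀ (c : ℝ) (y : C(ℝ, Vec n)), ∃ x : C(ℝ, Vec n), (∀ q ≤ c, x q = y q) ∧
      (t₀ ≤ c → ∀ s, c ≤ s → HeldEq f x (k (y c)) c s) := by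
    intro c y
    by_cases hc : t₀ ≤ c
    · obtain ⟨x, h1, h2⟩ := exists_heldEq (f := f) (u := k (y c)) (fun φ => hmeas φ _)
        (fun S => hlip S (y c))
        (fun S => by
          obtain ⟨F, hF⟩ := hbd S
          exact ⟨F, fun t h0 hS φ => hF t h0 hS φ _⟩) (ht₀.trans hc) y
      exact ⟨x, h1, fun _ => h2⟩
    · exact ⟨y, fun _ _ => rfl, fun h => absurd h hc⟩
  choose H H_le H_held using hheld
  have hτ' : -τ ≤ 0 := by linarith
  let y₀ : C(ℝ, Vec n) :=
    ⟨fun s => IccExtend hτ' φ (s - t₀),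
      (φ.continuous.Icc_extend' (h := hτ')).comp (continuous_id.sub continuous_const)⟩
  have hy₀ : ∀ s : Icc (-τ) (0 : ℝ), y₀ (t₀ + s) = φ s := by
    intro s
    have : t₀ + (s : ℝ) - t₀ = s := by ring
    simp only [y₀, ContinuousMap.coe_mk, this]
    exact IccExtend_val _ _ _
  let E : C(ℝ, Vec n) → EReal → EReal := fun y c => eventTime α₁ χ σ a b t₀ ⊤ y c
  let next : EReal × C(ℝ, Vec n) → EReal × C(ℝ, Vec n) := fun p =>
    (E p.2 p.1, open Classical in if E p.2 p.1 = ⊤ then p.2 else H (E p.2 p.1).toReal p.2)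
  let st : ℕ → EReal × C(ℝ, Vec n) := fun i => next^[i] ((t₀ : EReal), H t₀ y₀)
  let t : ℕ → EReal := fun i => (st i).1
  let Y : ℕ → C(ℝ, Vec n) := fun i => (st i).2
  have hst : ∀ i, st (i + 1) = next (st i) := fun i => Function.iterate_succ_apply' _ _ _
  have ht0 : t 0 = t₀ := rfl
  have hY0 : Y 0 = H t₀ y₀ := rfl
  have htS : ∀ i, t (i + 1) = eventTime α₁ χ σ a b t₀ ⊤ (Y i) (t i) := fun i => by
    simp only [t, hst]; rfl
  have hYtop : ∀ i, t (i + 1) = ⊤ → Y (i + 1) = Y i := by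
    intro i hi
    have hi' : E (st i).2 (st i).1 = ⊤ := by rw [← hi, htS]
    simp only [Y, hst, next, if_pos hi']
  have hYS : ∀ i, t (i + 1) ≠ ⊤ → Y (i + 1) = H (t (i + 1)).toReal (Y i) := by
    intro i hi
    have hi' : E (st i).2 (st i).1 ≠ ⊤ := by
      have := htS i
      rw [this] at hi; exact hi
    rw [htS]
    simp only [Y, hst, next, if_neg hi']
    rfl
  have hle : ∀ i, t i ≤ t (i + 1) := fun i => by rw [htS]; exact le_eventTime ..
  have hmono : Monotone t := monotone_nat_of_le_succ hle
  have ht₀le : ∀ i, (t₀ : EReal) ≤ t i := fun i => ht0 ▸ hmono (Nat.zero_le i)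
  have hreal : ∀ i, t i ≠ ⊤ → ((t i).toReal : EReal) = t i := fun i hi =>
    EReal.coe_toReal hi (ne_bot_of_le_ne_bot (EReal.coe_ne_bot t₀) (ht₀le i))
  have hagree : ∀ i, ∀ q : ℝ, (q : EReal) ≤ t (i + 1) → Y (i + 1) q = Y i q := by
    intro i q hq
    by_cases htop : t (i + 1) = ⊤
    · rw [hYtop i htop]
    · rw [hYS i htop]
      refine H_le _ _ q ?_
      rw [← hreal _ htop] at hq
      exact EReal.coe_le_coe_iff.1 hq
  have hagree' : ∀ i j, i ≤ j → ∀ q : ℝ, (q : EReal) ≤ t (i + 1) → Y j q = Y i q := by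
    intro i j hij q hq
    induction j, hij using Nat.le_induction with
    | base => rfl
    | succ j hij ih => rw [hagree j q (hq.trans (hmono (by omega))), ih]
  have hYheld : ∀ i, t i ≠ ⊤ → ∀ s, (t i).toReal ≤ s →
      HeldEq f (Y i) (k (Y i (t i).toReal)) (t i).toReal s := by
    intro i hi s hs
    cases i with
    | zero =>
      have h1 : (t 0).toReal = t₀ := by rw [ht0]; rfl
      rw [h1] at hs ⊢
      rw [hY0, H_le t₀ y₀ t₀ le_rfl]
      exact H_held t₀ y₀ le_rfl s hs
    | succ i =>
      rw [hYS i hi, H_le _ _ _ le_rfl]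
      refine H_held _ _ ?_ s hs
      rw [← EReal.coe_le_coe_iff, hreal _ hi]
      exact ht₀le _
  have hspec : ∀ i, t i ≠ ⊤ → _ := fun i hi =>
    eventTime_spec (t₀ := t₀) (b := b) hα hχ hσ ha (x := Y i) (c := (t i).toReal) (T := ⊤)
      (Y i).continuous.continuousOn
  -- Consecutive events are a positive time apart, so they exhaust the half-line.
  have hunb : ∀ S : ℝ, ∃ i, (S : EReal) < t (i + 1) := by
    intro S
    by_contra! hS
    have hfin : ∀ i, t i ≠ ⊤ := fun i h => by
      have := (hle i).trans (hS i)
      rw [h] at this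
      exact absurd this (not_le.2 (EReal.coe_lt_top S))
    have htS' : ∀ i, (t i).toReal ≤ S := fun i => by
      rw [← EReal.coe_le_coe_iff, hreal _ (hfin i)]
      exact (hle i).trans (hS i)
    have ht₀le' : ∀ i, t₀ ≤ (t i).toReal := fun i => by
      rw [← EReal.coe_le_coe_iff, hreal _ (hfin i)]
      exact ht₀le i
    obtain ⟨F, hF⟩ := hbd S
    set η := a * Real.exp (-b * (S - t₀)) with hη
    have hη0 : 0 < η := by positivity
    have hstep : ∀ i, η ≤ F * ((t (i + 1)).toReal - (t i).toReal) := by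
      intro i
      have h1 := (hspec i (hfin i)).2.2
      rw [hreal _ (hfin i), ← htS] at h1
      obtain ⟨r, hr1, hr2, -, hr4⟩ := h1 (hfin _)
      have hr : (t (i + 1)).toReal = r := by rw [hr1]; rfl
      have hrS : r ≤ S := hr ▸ htS' (i + 1)
      rw [hr]
      refine le_trans ?_ ((threshold_le_of_event hα hχ hσ ha hr4).trans
        ((hYheld i (hfin i) r hr2.le).norm_sub_le hr2.le fun q hq => hF q ?_ ?_ _ _))
      · rw [hη]
        gcongr ?_ * Real.exp ?_
        nlinarith
      · linarith [ht₀le' i, hq.1]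
      · exact hq.2.trans hrS
    refine not_forall_le_of_steps hη0 (fun i => ?_) hstep htS'
    exact (show (t 0).toReal = t₀ by rw [ht0]; rfl).le.trans (ht₀le' i)
  choose J hJ using hunb
  let x : ℝ → Vec n := fun q => Y (J q) q
  -- `Y i` is right up to the event time `t (i + 1)`, so the choice of `J q` does not matter.
  have hxY : ∀ i, ∀ q : ℝ, (q : EReal) ≤ t (i + 1) → x q = Y i q := by
    intro i q hq
    rcases le_total i (J q) with h | h
    · exact hagree' i _ h q hq
    · exact (hagree' _ i h q (hJ q).le).symm
  have hxc : Continuous x := by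
    rw [continuous_iff_continuousAt]
    intro q
    refine (Y (J q)).continuous.continuousAt.congr ?_
    filter_upwards [(continuous_coe_real_ereal.tendsto q).eventually_lt_const (hJ q)] with p hp
    exact (hxY _ p hp.le).symm
  refine ⟨x, t, ⟨EReal.coe_lt_top _, ?_, hxc.continuousOn, ht0, ?_, ?_, ?_⟩, hxc⟩
  · intro s
    have hs : t₀ + (s : ℝ) ≤ t₀ := by linarith [s.2.2]
    rw [hxY 0 _ ((EReal.coe_le_coe_iff.2 hs).trans (ht₀le 1)), hY0, H_le _ _ _ hs, hy₀]
  · intro i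
    change t (i + 1) = eventTime α₁ χ σ a b t₀ ⊤ x (t i)
    by_cases hi : t i = ⊤
    · rw [hi, eventTime_top]
      exact top_le_iff.1 (hi ▸ hle i)
    · rw [htS, ← hreal i hi]
      refine (eventTime_congr hα hχ hσ ha (Y i).continuous fun r hr => ?_).symm
      rw [hreal i hi, ← htS] at hr
      exact (hxY i r hr).symm
  · intro s hs _
    have hex : ∃ i, (s : EReal) < t (i + 1) := ⟨_, hJ s⟩
    classical
    refine ⟨Nat.find hex, ?_, Nat.find_spec hex⟩
    rcases h : Nat.find hex with _ | i
    · rw [ht0]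
      exact EReal.coe_le_coe_iff.2 hs
    · exact not_lt.1 (Nat.find_min hex (m := i) (by omega))
  · intro i s h1 h2 _
    have hi : t i ≠ ⊤ := fun h => by
      rw [h] at h1
      exact absurd h1 (not_le.2 (EReal.coe_lt_top s))
    have hs : (t i).toReal ≤ s := by
      rwa [← EReal.coe_le_coe_iff, hreal i hi]
    rw [hxY i _ ((hreal i hi).le.trans (hle i))]
    refine (hYheld i hi s hs).congr hτ hs fun r hr => (hxY i r ?_).symm
    exact (EReal.coe_le_coe_iff.2 hr.2).trans h2.le

end Existence

/-! ### A comparison principle for Dini derivatives -/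

section Comparison

/-- Comparison principle: the differential inequality `D⁺w ≤ -ν w + D` yields exponential decay up to
`D / ν`. -/
theorem le_of_diniUpper_le {w : ℝ → ℝ} {c s ν D : ℝ} (hν : 0 < ν) (hD : 0 ≤ D) (hcs : c ≤ s)
    (hw : ContinuousOn w (Icc c s))
    (hd : ∀ r ∈ Ico c s, diniUpper w r ≤ ((-ν * w r + D : ℝ) : EReal)) :
    w s ≤ Real.exp (-ν * (s - c)) * w c + D / ν := by
  -- With any `D' > D` the right-hand side becomes a strict supersolution.
  have key : ∀ D', D < D' → w s ≤ Real.exp (-ν * (s - c)) * w c + D' / ν := by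
    intro D' hDD'
    refine image_le_of_liminf_slope_right_lt_deriv_boundary' (f' := fun r => -ν * w r + D)
      (B := fun r => Real.exp (-ν * (r - c)) * w c + D' / ν)
      (B' := fun r => -ν * (Real.exp (-ν * (r - c)) * w c)) hw ?_ ?_ (by fun_prop) ?_ ?_
      ⟨hcs, le_rfl⟩
    · intro r hr ρ hρ
      have h1 : limsup (fun h : ℝ => (((w (r + h) - w r) / h : ℝ) : EReal)) (𝓝[>] 0) <
          (ρ : EReal) := (hd r hr).trans_lt (EReal.coe_lt_coe_iff.2 hρ)
      have h2 := eventually_lt_of_limsup_lt h1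
      have h3 : Tendsto (fun z => z - r) (𝓝[>] r) (𝓝[>] 0) := by
        refine tendsto_nhdsWithin_iff.2 ⟨?_, ?_⟩
        · have : Tendsto (fun z => z - r) (𝓝 r) (𝓝 (r - r)) :=
            (continuous_id.sub continuous_const).tendsto r
          rw [sub_self] at this
          exact this.mono_left nhdsWithin_le_nhds
        · filter_upwards [self_mem_nhdsWithin] with z hz
          exact mem_Ioi.2 (sub_pos.2 (mem_Ioi.1 hz))
      refine ((h3.eventually h2).mono fun z hz => ?_).frequently
      rw [EReal.coe_lt_coe_iff, add_sub_cancel] at hz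
      rwa [slope_def_field]
    · have : 0 ≤ D' / ν := div_nonneg (hD.trans hDD'.le) hν.le
      simp only [sub_self, mul_zero, Real.exp_zero, one_mul]
      linarith
    · intro r _
      have h1 : HasDerivAt (fun r : ℝ => -ν * (r - c)) (-ν) r := by
        simpa using ((hasDerivAt_id r).sub_const c).const_mul (-ν)
      exact (((h1.exp.mul_const (w c)).add_const (D' / ν)).congr_deriv (by ring)).hasDerivWithinAt
    · intro r _ hr
      rw [hr]
      have : ν * (D' / ν) = D' := mul_div_cancel₀ _ hν.ne'
      nlinarith
  refine le_of_forall_pos_le_add fun ε hε => (key (D + ν * ε) (by nlinarith [mul_pos hν hε])).trans ?_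
  rw [add_div, mul_div_cancel_left₀ _ hν.ne', add_assoc]

end Comparison

/-! ### Decay of the Lyapunov functional -/

section Lyapunov
variable {n m : ℕ} {τ : ℝ} {f : ℝ → Hist τ n → Vec m → Vec n} {k : Vec n → Vec m}
  {V₁ : ℝ → Vec n → ℝ} {V₂ : ℝ → Hist τ n → ℝ} {α₁ α₂ α₃ χ : ℝ → ℝ} {μ : ℝ}

theorem continuousOn_lyap (hτ : 0 ≤ τ) (hV₁ : ClassV0 V₁) (hV₂ : ClassV0Star τ V₂) {x : ℝ → Vec n}
    {c s : ℝ} (hc : 0 ≤ c) (hcs : c ≤ s) (hx : ContinuousOn x (Icc (c - τ) s)) :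
    ContinuousOn (lyap V₁ V₂ x) (Icc c s) := by
  obtain ⟨y, hy⟩ := exists_continuous_eqOn_Icc (by linarith) hx
  have h : ContinuousOn (lyap V₁ V₂ y) (Ici 0) :=
    (hV₁.continuousOn y y.continuous.continuousOn).add
      (hV₂.continuousOn y y.continuous.continuousOn)
  refine (h.mono fun r hr => hc.trans hr.1).congr fun r hr => ?_
  rw [lyap, lyap, hist_congr (hy.mono (Icc_subset_Icc (by linarith [hr.1]) hr.2)),
    hy ⟨by linarith [hr.1], hr.2⟩]

theorem LyapunovConditions.le_lyap (hV : LyapunovConditions f k V₁ V₂ α₁ α₂ α₃ χ μ) {x : ℝ → Vec n}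
    {r : ℝ} (hr : 0 ≤ r) : α₁ ‖x r‖ ≤ lyap V₁ V₂ x r := by
  have h1 := (hV.bounds_one r hr (x r)).1
  have h2 := (hV.bounds_two r hr (hist τ x r)).1
  rw [lyap]
  linarith

theorem LyapunovConditions.lyap_le (hV : LyapunovConditions f k V₁ V₂ α₁ α₂ α₃ χ μ) {x : ℝ → Vec n}
    {r B : ℝ} (hr : 0 ≤ r) (h1 : ‖x r‖ ≤ B) (h2 : ‖hist τ x r‖ ≤ B) :
    lyap V₁ V₂ x r ≤ α₂ B + α₃ B :=
  add_le_add
    ((hV.bounds_one r hr (x r)).2.trans (hV.classK_two.toClassK.mono (norm_nonneg _) h1))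
    ((hV.bounds_two r hr (hist τ x r)).2.trans (hV.classK_three.toClassK.mono (norm_nonneg _) h2))

/-- Decay of the functional along a function that locally follows held inputs whose sampling error
satisfies the bound enforced by the triggering rule: the term `σ α₁(‖x‖) ≤ σ V` consumes part of the
decay rate `μ`. -/
theorem LyapunovConditions.decay (hV : LyapunovConditions f k V₁ V₂ α₁ α₂ α₃ χ μ) (hτ : 0 ≤ τ)
    {σ D c s : ℝ} (hσ : 0 ≤ σ) (hσμ : σ < μ) (hD : 0 ≤ D) {x : ℝ → Vec n} (hc : 0 ≤ c)
    (hcs : c ≤ s) (hx : ContinuousOn x (Icc (c - τ) s))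
    (h : ∀ r ∈ Ico c s, ∃ z, ∃ e ∈ Ioc r s, (∀ q ∈ Ico r e, HeldEq f x (k z) r q) ∧
      χ ‖z - x r‖ ≤ σ * α₁ ‖x r‖ + D) :
    lyap V₁ V₂ x s ≤ Real.exp (-(μ - σ) * (s - c)) * lyap V₁ V₂ x c + D / (μ - σ) := by
  refine le_of_diniUpper_le (by linarith) hD hcs
    (continuousOn_lyap hτ hV.classV0 hV.classV0Star hc hcs hx) fun r hr => ?_
  obtain ⟨z, e, he, hheld, hz⟩ := h r hr
  have hr0 : 0 ≤ r := hc.trans hr.1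
  have hre : r + (e - r) = e := by ring
  refine (hV.dini_le r (e - r) hr0 (by linarith [he.1]) x z ?_ ?_).trans
    (EReal.coe_le_coe_iff.2 ?_)
  · rw [hre]
    exact hx.mono fun q hq => ⟨by linarith [hq.1, hr.1], hq.2.le.trans he.2⟩
  · rwa [hre]
  · have := mul_le_mul_of_nonneg_left (hV.le_lyap (x := x) hr0) hσ
    linarith

/-- A level that bounds all states compatible with the decay estimate. -/
theorem LyapunovConditions.exists_bound (hV : LyapunovConditions f k V₁ V₂ α₁ α₂ α₃ χ μ)
    (ρ w : ℝ) : ∃ R, ρ < R ∧ 0 < R ∧ ∀ y, α₁ y ≤ w → y < R := by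
  have h := (hV.classK_one.tendsto_atTop.eventually_gt_atTop w).and
    (eventually_gt_atTop (max ρ 0))
  obtain ⟨R, hR⟩ := eventually_atTop.1 h
  refine ⟨R, (le_max_left _ _).trans_lt (hR R le_rfl).2, (le_max_right _ _).trans_lt (hR R le_rfl).2,
    fun y hy => ?_⟩
  by_contra! hle
  exact absurd hy (not_le.2 (hR y hle).1)

end Lyapunov

/-! ### Closed-loop solutions -/

section ClosedLoop
variable {n m : ℕ} {τ : ℝ} {f : ℝ → Hist τ n → Vec m → Vec n} {k : Vec n → Vec m}
  {α₁ χ : ℝ → ℝ} {σ a b t₀ : ℝ} {φ : Hist τ n} {T : EReal} {x : ℝ → Vec n} {t : ℕ → EReal}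

namespace IsClosedLoopSolution

theorem succ_eq (h : IsClosedLoopSolution f k α₁ χ σ a b t₀ φ T x t) (i : ℕ) :
    t (i + 1) = eventTime α₁ χ σ a b t₀ T x (t i) :=
  h.event_succ i

theorem monotone (h : IsClosedLoopSolution f k α₁ χ σ a b t₀ φ T x t) : Monotone t :=
  monotone_nat_of_le_succ fun i => by rw [h.succ_eq]; exact le_eventTime ..

theorem le_event (h : IsClosedLoopSolution f k α₁ χ σ a b t₀ φ T x t) (i : ℕ) :
    (t₀ : EReal) ≤ t i := h.event_zero ▸ h.monotone (Nat.zero_le i)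

theorem coe_toReal (h : IsClosedLoopSolution f k α₁ χ σ a b t₀ φ T x t) {i : ℕ} (hi : t i ≠ ⊤) :
    ((t i).toReal : EReal) = t i :=
  EReal.coe_toReal hi (ne_bot_of_le_ne_bot (EReal.coe_ne_bot t₀) (h.le_event i))

theorem le_toReal (h : IsClosedLoopSolution f k α₁ χ σ a b t₀ φ T x t) {i : ℕ} (hi : t i ≠ ⊤) :
    t₀ ≤ (t i).toReal := by
  rw [← EReal.coe_le_coe_iff, h.coe_toReal hi]
  exact h.le_event i

theorem continuousOn_Icc (h : IsClosedLoopSolution f k α₁ χ σ a b t₀ φ T x t) {p q : ℝ}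
    (hp : t₀ - τ ≤ p) (hq : (q : EReal) < T) : ContinuousOn x (Icc p q) :=
  h.continuousOn.mono fun _ hr => ⟨hp.trans hr.1, (EReal.coe_le_coe_iff.2 hr.2).trans_lt hq⟩

theorem hist_start (h : IsClosedLoopSolution f k α₁ χ σ a b t₀ φ T x t) : hist τ x t₀ = φ := by
  ext1 s
  rw [hist_apply (h.continuousOn_Icc le_rfl h.lt_end), h.init]

theorem norm_le_of_le_start (h : IsClosedLoopSolution f k α₁ χ σ a b t₀ φ T x t) {r : ℝ}
    (h1 : t₀ - τ ≤ r) (h2 : r ≤ t₀) : ‖x r‖ ≤ ‖φ‖ := by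
  have := h.init ⟨r - t₀, by linarith, by linarith⟩
  rw [add_sub_cancel] at this
  rw [this]
  exact φ.norm_coe_le_norm _

theorem event_spec (h : IsClosedLoopSolution f k α₁ χ σ a b t₀ φ T x t) (hτ : 0 ≤ τ)
    (hα : ClassKInf α₁) (hχ : ClassK χ) (hσ : 0 ≤ σ) (ha : 0 < a) {i : ℕ} (hi : t i ≠ ⊤) :
    t i < t (i + 1) ∧
      (∀ r : ℝ, (t i).toReal ≤ r → (r : EReal) < T → (r : EReal) < t (i + 1) →
        χ ‖x (t i).toReal - x r‖ ≤ σ * α₁ ‖x r‖ + χ (a * Real.exp (-b * (r - t₀)))) ∧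
      (t (i + 1) ≠ ⊤ →
        ∃ r : ℝ, t (i + 1) = r ∧ (t i).toReal < r ∧ (r : EReal) < T ∧
          χ ‖x (t i).toReal - x r‖ = σ * α₁ ‖x r‖ + χ (a * Real.exp (-b * (r - t₀)))) := by
  have := eventTime_spec (t₀ := t₀) (b := b) hα hχ hσ ha (x := x) (c := (t i).toReal) (T := T)
    (h.continuousOn.mono fun r hr => ⟨by linarith [h.le_toReal hi, hr.1], hr.2⟩)
  rwa [h.coe_toReal hi, ← h.succ_eq] at this

/-- Around every time the solution follows a held input whose sampling error satisfies the bound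
enforced by the triggering rule. -/
theorem locally_held (h : IsClosedLoopSolution f k α₁ χ σ a b t₀ φ T x t) (hτ : 0 ≤ τ)
    (hα : ClassKInf α₁) (hχ : ClassK χ) (hσ : 0 ≤ σ) (ha : 0 < a) {r s : ℝ} (hr : t₀ ≤ r)
    (hrs : r < s) (hs : (r : EReal) < T) :
    ∃ p ∈ Icc t₀ r, χ ‖x p - x r‖ ≤ σ * α₁ ‖x r‖ + χ (a * Real.exp (-b * (r - t₀))) ∧
      ∃ e ∈ Ioc r s, ∀ q ∈ Ico r e, (q : EReal) < T → HeldEq f x (k (x p)) r q := by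
  obtain ⟨i, h1, h2⟩ := h.cover r hr hs
  have hi : t i ≠ ⊤ := ne_top_of_le_ne_top (EReal.coe_ne_top r) h1
  have hir : (t i).toReal ≤ r := by rwa [← EReal.coe_le_coe_iff, h.coe_toReal hi]
  obtain ⟨e, he1, he2⟩ := EReal.lt_iff_exists_real_btwn.1 h2
  refine ⟨(t i).toReal, ⟨h.le_toReal hi, hir⟩,
    (h.event_spec hτ hα hχ hσ ha hi).2.1 r hir hs h2, min e s,
    ⟨lt_min (EReal.coe_lt_coe_iff.1 he1) hrs, min_le_right _ _⟩, fun q hq hqT => ?_⟩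
  have hqe : (q : EReal) < t (i + 1) :=
    (EReal.coe_lt_coe_iff.2 (hq.2.trans_le (min_le_left _ _))).trans he2
  exact (h.dynamics i r h1 h2 hs).sub
    (h.dynamics i q (h1.trans (EReal.coe_le_coe_iff.2 hq.1)) hqe hqT)

theorem norm_sub_le_of_event (h : IsClosedLoopSolution f k α₁ χ σ a b t₀ φ T x t) (hτ : 0 ≤ τ)
    {i : ℕ} (hi : t i ≠ ⊤) {r F : ℝ} (hr : t (i + 1) = r) (hir : (t i).toReal < r)
    (hrT : (r : EReal) < T)
    (hF : ∀ q ∈ Icc (t i).toReal r, ‖f q (hist τ x q) (k (x (t i).toReal))‖ ≤ F) :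
    ‖x (t i).toReal - x r‖ ≤ F * (r - (t i).toReal) := by
  set c := (t i).toReal
  have hcl : closure (Ico c r) = Icc c r := closure_Ico hir.ne
  have hx : ContinuousOn x (Icc c r) := h.continuousOn_Icc (by linarith [h.le_toReal hi]) hrT
  refine le_on_closure (s := Ico c r) (f := fun q => ‖x c - x q‖) (g := fun q => F * (q - c))
    (fun q hq => ?_) ?_ (by fun_prop) (by rw [hcl]; exact ⟨hir.le, le_rfl⟩)
  · refine (h.dynamics i q ?_ ?_ ?_).norm_sub_le hq.1 fun p hp => hF p ⟨hp.1, hp.2.trans hq.2.le⟩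
    · rw [← h.coe_toReal hi]
      exact EReal.coe_le_coe_iff.2 hq.1
    · rw [hr]
      exact EReal.coe_lt_coe_iff.2 hq.2
    · exact (EReal.coe_lt_coe_iff.2 hq.2).trans hrT
  · rw [hcl]
    exact (continuousOn_const.sub hx).norm

end IsClosedLoopSolution

end ClosedLoop

/-! ### Radial clipping -/

section Clip
variable {E : Type*} [NormedAddCommGroup E] [NormedSpace ℝ E]

/-- The radial retraction onto the closed ball of radius `R > 0` around `0`. -/
noncomputable def clip (R : ℝ) (v : E) : E := (R / max R ‖v‖) • v

theorem norm_clip_le {R : ℝ} (hR : 0 < R) (v : E) : ‖clip R v‖ ≤ R := by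
  have h : 0 < max R ‖v‖ := lt_max_of_lt_left hR
  rw [clip, norm_smul, Real.norm_of_nonneg (by positivity), div_mul_eq_mul_div, div_le_iff₀ h]
  exact mul_le_mul_of_nonneg_left (le_max_right _ _) hR.le

theorem clip_eq_self {R : ℝ} (hR : 0 < R) {v : E} (hv : ‖v‖ ≤ R) : clip R v = v := by
  rw [clip, max_eq_left hv, div_self hR.ne', one_smul]

theorem norm_clip_sub_clip_le {R : ℝ} (hR : 0 < R) (v w : E) :
    ‖clip R v - clip R w‖ ≤ 2 * ‖v - w‖ := by
  set p := max R ‖v‖ with hp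
  set q := max R ‖w‖ with hq
  have hp0 : 0 < p := lt_max_of_lt_left hR
  have hq0 : 0 < q := lt_max_of_lt_left hR
  have hRp : R / p ≤ 1 := (div_le_one hp0).2 (le_max_left _ _)
  have hwq : ‖w‖ / q ≤ 1 := (div_le_one hq0).2 (le_max_right _ _)
  have hpq : |q - p| ≤ ‖v - w‖ := by
    rw [abs_sub_comm]
    rw [hp, hq, max_comm R, max_comm R]
    exact (abs_max_sub_max_le_abs _ _ _).trans (abs_norm_sub_norm_le v w)
  have hsplit : clip R v - clip R w = (R / p) • (v - w) + (R / p * ((q - p) / q)) • w := by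
    have : R / q = R / p - R / p * ((q - p) / q) := by
      field_simp
      ring
    rw [clip, clip, ← hp, ← hq, this, sub_smul, smul_sub]
    abel
  rw [hsplit]
  refine (norm_add_le _ _).trans ?_
  rw [norm_smul, norm_smul, norm_mul, norm_div, norm_div, Real.norm_of_nonneg hR.le,
    Real.norm_of_nonneg hp0.le, Real.norm_of_nonneg hq0.le, Real.norm_eq_abs]
  have h1 : R / p * ‖v - w‖ ≤ ‖v - w‖ := mul_le_of_le_one_left (norm_nonneg _) hRp
  have h2 : R / p * (|q - p| / q) * ‖w‖ ≤ ‖v - w‖ := by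
    calc R / p * (|q - p| / q) * ‖w‖ = R / p * (‖w‖ / q) * |q - p| := by ring
      _ ≤ 1 * |q - p| := by
        refine mul_le_mul_of_nonneg_right ?_ (abs_nonneg _)
        exact mul_le_one₀ hRp (by positivity) hwq
      _ ≤ _ := by rwa [one_mul]
  linarith

end Clip

/-! ### A priori bound, well-posedness, events and attractivity -/

section Main
variable {n m : ℕ} {τ : ℝ} {f : ℝ → Hist τ n → Vec m → Vec n} {k : Vec n → Vec m}
  {V₁ : ℝ → Vec n → ℝ} {V₂ : ℝ → Hist τ n → ℝ} {α₁ α₂ α₃ χ : ℝ → ℝ} {μ : ℝ} {σ a b t₀ : ℝ}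

theorem ClassK.threshold_le {χ : ℝ → ℝ} (hχ : ClassK χ) (ha : 0 < a) (hb : 0 ≤ b) {p q : ℝ}
    (hpq : p ≤ q) :
    χ (a * Real.exp (-b * (q - t₀))) ≤ χ (a * Real.exp (-b * (p - t₀))) := by
  refine hχ.mono (by positivity) ?_
  gcongr ?_ * Real.exp ?_
  nlinarith

/-- Decay of the functional along closed-loop solutions from any time `c` on, up to the threshold
that is valid from the time `c` on. -/
theorem IsClosedLoopSolution.decay {φ : Hist τ n} {T : EReal} {x : ℝ → Vec n} {t : ℕ → EReal}
    (h : IsClosedLoopSolution f k α₁ χ σ a b t₀ φ T x t)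
    (hV : LyapunovConditions f k V₁ V₂ α₁ α₂ α₃ χ μ) (hτ : 0 ≤ τ) (hσ : 0 ≤ σ) (hσμ : σ < μ)
    (ha : 0 < a) (hb : 0 ≤ b) (ht₀ : 0 ≤ t₀) {c s : ℝ} (hc : t₀ ≤ c) (hcs : c ≤ s)
    (hs : (s : EReal) < T) :
    lyap V₁ V₂ x s ≤ Real.exp (-(μ - σ) * (s - c)) * lyap V₁ V₂ x c +
      χ (a * Real.exp (-b * (c - t₀))) / (μ - σ) := by
  refine hV.decay hτ hσ hσμ (hV.classK_chi.nonneg (by positivity)) (ht₀.trans hc) hcs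
    (h.continuousOn_Icc (by linarith) hs) fun r hr => ?_
  have hrT : (r : EReal) < T := (EReal.coe_lt_coe_iff.2 hr.2).trans hs
  obtain ⟨p, -, hp, e, he, hheld⟩ :=
    h.locally_held hτ hV.classK_one hV.classK_chi hσ ha (hc.trans hr.1) hr.2 hrT
  refine ⟨x p, e, he, fun q hq => hheld q hq ?_, hp.trans ?_⟩
  · exact (EReal.coe_lt_coe_iff.2 (hq.2.trans_le he.2)).trans hs
  · exact add_le_add le_rfl (hV.classK_chi.threshold_le ha hb hr.1)

/-- A priori bound for closed-loop solutions, uniform for bounded initial functions. -/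
theorem exists_norm_le (hV : LyapunovConditions f k V₁ V₂ α₁ α₂ α₃ χ μ) (hτ : 0 ≤ τ) (hσ : 0 ≤ σ)
    (hσμ : σ < μ) (ha : 0 < a) (hb : 0 ≤ b) (ht₀ : 0 ≤ t₀) (ρ : ℝ) :
    ∃ R, 0 < R ∧ ∀ (φ : Hist τ n) (T : EReal) (x : ℝ → Vec n) (t : ℕ → EReal), ‖φ‖ ≤ ρ →
      IsClosedLoopSolution f k α₁ χ σ a b t₀ φ T x t →
      ∀ r, t₀ - τ ≤ r → (r : EReal) < T → ‖x r‖ ≤ R := by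
  obtain ⟨R, hρR, hR, hbd⟩ := hV.exists_bound ρ (α₂ ρ + α₃ ρ + χ a / (μ - σ))
  refine ⟨R, hR, fun φ T x t hφ h r hr hrT => ?_⟩
  rcases le_total r t₀ with hr0 | hr0
  · exact (h.norm_le_of_le_start hr hr0).trans (hφ.trans hρR.le)
  · refine (hbd _ ?_).le
    have h1 := h.decay hV hτ hσ hσμ ha hb ht₀ le_rfl hr0 hrT
    have h2 : lyap V₁ V₂ x t₀ ≤ α₂ ρ + α₃ ρ :=
      hV.lyap_le ht₀ ((h.norm_le_of_le_start (by linarith) le_rfl).trans hφ) (h.hist_start ▸ hφ)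
    have h3 : 0 ≤ lyap V₁ V₂ x t₀ :=
      (hV.classK_one.toClassK.nonneg (norm_nonneg _)).trans (hV.le_lyap ht₀)
    have h4 : Real.exp (-(μ - σ) * (r - t₀)) ≤ 1 := by
      rw [Real.exp_le_one_iff]
      nlinarith
    have h5 := hV.le_lyap (x := x) (ht₀.trans hr0)
    have h6 := mul_le_of_le_one_left h3 h4
    simp only [sub_self, mul_zero, Real.exp_zero, mul_one] at h1
    linarith

/-- Existence of a global closed-loop solution: a solution for the field clipped at a large radius `R`
never reaches the norm `R`, by the decay estimate, so it does not notice the clipping. -/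
theorem exists_global_solution (hV : LyapunovConditions f k V₁ V₂ α₁ α₂ α₃ χ μ) (hτ : 0 ≤ τ)
    (hf_zero : ∀ t, 0 ≤ t → f t 0 0 = 0) (hf_meas : ∀ φ u, Measurable fun t : ℝ≥0 => f t φ u)
    (hσ : 0 ≤ σ) (hσμ : σ < μ) (ha : 0 < a) (hb : 0 ≤ b) (ht₀ : 0 ≤ t₀) (hk : Continuous k)
    (hf : LocLipField f) (φ : Hist τ n) :
    ∃ x t, IsClosedLoopSolution f k α₁ χ σ a b t₀ φ ⊤ x t := by
  obtain ⟨R, hρR, hR, hbd⟩ := hV.exists_bound ‖φ‖ (α₂ ‖φ‖ + α₃ ‖φ‖ + χ a / (μ - σ))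
  obtain ⟨K, hK⟩ := (isCompact_closedBall (0 : Vec n) R).exists_bound_of_continuousOn
    hk.continuousOn
  have hKclip : ∀ z, ‖k (clip R z)‖ ≤ K := fun z =>
    hK _ (mem_closedBall_zero_iff.2 (norm_clip_le hR z))
  have hRK : R ≤ max R K := le_max_left _ _
  have hKR : K ≤ max R K := le_max_right _ _
  obtain ⟨x, t, h, hxc⟩ := exists_closedLoopSolution (f := fun t ψ u => f t (clip R ψ) u)
    (k := fun z => k (clip R z)) (α₁ := α₁) (χ := χ) (σ := σ) (a := a) (b := b) (t₀ := t₀)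
    hτ hV.classK_one hV.classK_chi hσ ha hb ht₀ (fun ψ u => hf_meas (clip R ψ) u)
    (fun S z => by
      obtain ⟨L, hL, h⟩ := hf.exists_pos S (max R K)
      refine ⟨L * 2, by positivity, fun t h0 hS ψ ψ' => ?_⟩
      refine ((h t h0 hS).1 _ _ _ ((norm_clip_le hR ψ).trans hRK) ((norm_clip_le hR ψ').trans hRK)
        ((hKclip z).trans hKR)).trans ?_
      rw [mul_assoc]
      exact mul_le_mul_of_nonneg_left (norm_clip_sub_clip_le hR ψ ψ') hL.le)
    (fun S => by
      obtain ⟨L, hL, h⟩ := hf.exists_linear_bound hf_zero S (max R K)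
      refine ⟨L * (R + K), fun t h0 hS ψ z => ?_⟩
      refine (h t h0 hS _ _ ((norm_clip_le hR ψ).trans hRK) ((hKclip z).trans hKR)).trans ?_
      exact mul_le_mul_of_nonneg_left (add_le_add (norm_clip_le hR ψ) (hKclip z)) hL.le) φ
  have hunclip : ∀ (p q r : ℝ), ‖x p‖ ≤ R → q ≤ r → (∀ w ∈ Icc (q - τ) r, ‖x w‖ ≤ R) →
      HeldEq (fun t ψ u => f t (clip R ψ) u) x (k (clip R (x p))) q r →
      HeldEq f x (k (x p)) q r := by
    intro p q r hp hqr hw hheld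
    refine hheld.congr_field hqr fun w hwm => ?_
    have : ‖hist τ x w‖ ≤ R :=
      norm_hist_le hR.le fun v hv => hw v ⟨by linarith [hv.1, hwm.1], hv.2.trans hwm.2⟩
    simp only [clip_eq_self hR this, clip_eq_self hR hp]
  have hlt : ∀ r, t₀ - τ ≤ r → ‖x r‖ < R := by
    by_contra! hex
    obtain ⟨r₁, hr₁, hRr₁⟩ := hex
    have hr₁0 : t₀ ≤ r₁ := by
      by_contra! hlt
      exact absurd hRr₁ (not_le.2 ((h.norm_le_of_le_start hr₁ hlt.le).trans_lt hρR))
    -- `s` is the first time at which the norm `R` is reached; before it the clipping is not felt.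
    have hcl : IsClosed (Icc t₀ r₁ ∩ {r | R ≤ ‖x r‖}) :=
      isClosed_Icc.inter (isClosed_le continuous_const hxc.norm)
    obtain ⟨s, hs, hmin⟩ := (isCompact_Icc.of_isClosed_subset hcl inter_subset_left).exists_isLeast
      ⟨r₁, ⟨hr₁0, le_rfl⟩, hRr₁⟩
    have hbefore : ∀ r, t₀ - τ ≤ r → r < s → ‖x r‖ < R := by
      intro r h1 h2
      rcases le_total r t₀ with h3 | h3
      · exact (h.norm_le_of_le_start h1 h3).trans_lt hρR
      · by_contra! h4
        exact absurd (hmin ⟨⟨h3, h2.le.trans hs.1.2⟩, h4⟩) (not_le.2 h2)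
    have hdecay := hV.decay hτ hσ hσμ (D := χ a) (hV.classK_chi.nonneg ha.le) ht₀ hs.1.1
      hxc.continuousOn (x := x) fun r hr => by
        obtain ⟨p, hp, hpχ, e, he, hheld⟩ := h.locally_held hτ hV.classK_one hV.classK_chi hσ ha
          hr.1 hr.2 (EReal.coe_lt_top r)
        refine ⟨x p, e, he, fun q hq => ?_, hpχ.trans (add_le_add le_rfl ?_)⟩
        · refine hunclip p r q (hbefore p (by linarith [hp.1]) (hp.2.trans_lt hr.2)).le hq.1
            (fun w hw => (hbefore w (by linarith [hw.1, hr.1])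
              (hw.2.trans_lt (hq.2.trans_le he.2))).le) ?_
          exact hheld q hq (EReal.coe_lt_top q)
        · have := hV.classK_chi.threshold_le (t₀ := t₀) ha hb hr.1
          simpa using this
    have h2 : lyap V₁ V₂ x t₀ ≤ α₂ ‖φ‖ + α₃ ‖φ‖ :=
      hV.lyap_le ht₀ (h.norm_le_of_le_start (by linarith) le_rfl) (h.hist_start ▸ le_rfl)
    have h3 : 0 ≤ lyap V₁ V₂ x t₀ :=
      (hV.classK_one.toClassK.nonneg (norm_nonneg _)).trans (hV.le_lyap ht₀)
    have h4 : Real.exp (-(μ - σ) * (s - t₀)) ≤ 1 := by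
      rw [Real.exp_le_one_iff]
      nlinarith [hs.1.1]
    have h5 := hV.le_lyap (x := x) (ht₀.trans hs.1.1)
    have h6 := mul_le_of_le_one_left h3 h4
    exact absurd hs.2 (not_le.2 (hbd _ (by linarith)))
  refine ⟨x, t, h.lt_end, h.init, h.continuousOn, h.event_zero, h.event_succ, h.cover,
    fun i s h1 h2 h3 => ?_⟩
  have hi : t i ≠ ⊤ := ne_top_of_le_ne_top (EReal.coe_ne_top s) h1
  have h0 := h.le_toReal hi
  refine hunclip _ _ _ (hlt _ (by linarith)).le ?_ (fun w hw => (hlt w (by linarith [hw.1])).le)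
    (h.dynamics i s h1 h2 h3)
  rwa [← EReal.coe_le_coe_iff, h.coe_toReal hi]

/-- If two solutions agree up to the next event of the first one, and the second one has no earlier
event, then the second one has the same event. -/
theorem IsClosedLoopSolution.succ_le_succ {φ : Hist τ n} {T T' : EReal} {x y : ℝ → Vec n}
    {t s : ℕ → EReal} (hx : IsClosedLoopSolution f k α₁ χ σ a b t₀ φ T x t)
    (hy : IsClosedLoopSolution f k α₁ χ σ a b t₀ φ T' y s) (hτ : 0 ≤ τ) (hα : ClassKInf α₁)
    (hχ : ClassK χ) (hσ : 0 ≤ σ) (ha : 0 < a) {i : ℕ} (hi : t i = s i) (hitop : t i ≠ ⊤)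
    (hT : t (i + 1) < T') (hxy : ∀ r : ℝ, t₀ ≤ r → (r : EReal) ≤ t (i + 1) → x r = y r) :
    s (i + 1) ≤ t (i + 1) := by
  obtain ⟨-, -, h3⟩ := hx.event_spec hτ hα hχ hσ ha hitop
  obtain ⟨r, hr1, hr2, -, hr4⟩ := h3 (ne_top_of_lt hT)
  have h0 := hx.le_toReal hitop
  have hcr : t i ≤ r := by
    rw [← hx.coe_toReal hitop]
    exact EReal.coe_le_coe_iff.2 hr2.le
  rw [hr1] at hT hxy ⊢
  rw [hy.succ_eq]
  refine sInf_le ⟨r, rfl, hi ▸ hcr, hT, ?_⟩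
  rw [← hi, ← hxy r (by linarith) le_rfl, ← hxy _ h0 ((hx.coe_toReal hitop).le.trans hcr), hr4]

/-- Two closed-loop solutions with the same initial function agree on their common interval. -/
theorem IsClosedLoopSolution.unique {φ : Hist τ n} {T T' : EReal} {x y : ℝ → Vec n}
    {t s : ℕ → EReal} (hx : IsClosedLoopSolution f k α₁ χ σ a b t₀ φ T x t)
    (hy : IsClosedLoopSolution f k α₁ χ σ a b t₀ φ T' y s) (hτ : 0 ≤ τ) (hα : ClassKInf α₁)
    (hχ : ClassK χ) (hσ : 0 ≤ σ) (ha : 0 < a) (ht₀ : 0 ≤ t₀) (hf : LocLipField f) {r : ℝ}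
    (hr : t₀ - τ ≤ r) (hrT : (r : EReal) < T) (hrT' : (r : EReal) < T') : x r = y r := by
  have hpast : ∀ q, t₀ - τ ≤ q → q ≤ t₀ → x q = y q := by
    intro q h1 h2
    have e1 := hx.init ⟨q - t₀, by linarith, by linarith⟩
    have e2 := hy.init ⟨q - t₀, by linarith, by linarith⟩
    rw [add_sub_cancel] at e1 e2
    rw [e1, e2]
  -- The event times need to agree only before `min T T'`: a later event of the one solution may be
  -- missing for the other one.
  have key : ∀ i, (t i < min T T' ∨ s i < min T T' → t i = s i) ∧
      ∀ q : ℝ, t₀ - τ ≤ q → (q : EReal) < min T T' → (q : EReal) ≤ t i → (q : EReal) ≤ s i →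
        x q = y q := by
    intro i
    induction i with
    | zero =>
      refine ⟨fun _ => by rw [hx.event_zero, hy.event_zero], fun q h1 _ h2 _ => ?_⟩
      rw [hx.event_zero, EReal.coe_le_coe_iff] at h2
      exact hpast q h1 h2
    | succ i ih =>
      obtain ⟨ih1, ih2⟩ := ih
      by_cases hi : t i < min T T' ∨ s i < min T T'
      swap
      -- The common interval is exhausted.
      · rw [not_or, not_lt, not_lt] at hi
        have h1 := hi.1.trans (hx.monotone i.le_succ)
        have h2 := hi.2.trans (hy.monotone i.le_succ)
        refine ⟨fun h => ?_, fun q h3 h4 _ _ => ih2 q h3 h4 (h4.le.trans hi.1) (h4.le.trans hi.2)⟩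
        exact h.elim (fun h => absurd h (not_lt.2 h1)) (fun h => absurd h (not_lt.2 h2))
      · have hts := ih1 hi
        have hiT : t i < min T T' := hi.elim id fun h => by rwa [hts]
        have hitop : t i ≠ ⊤ := ne_top_of_lt hiT
        have hc0 := hx.le_toReal hitop
        have hc := hx.coe_toReal hitop
        set c := (t i).toReal with hcdef
        have hceq : (s i).toReal = c := by rw [← hts]
        have hagc : ∀ q, t₀ - τ ≤ q → q ≤ c → x q = y q := by
          intro q h1 h2
          have h3 : (q : EReal) ≤ t i := by
            rw [← hc]
            exact EReal.coe_le_coe_iff.2 h2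
          exact ih2 q h1 (h3.trans_lt hiT) h3 (hts ▸ h3)
        have hag : ∀ q : ℝ, t₀ - τ ≤ q → (q : EReal) < min T T' → (q : EReal) ≤ t (i + 1) →
            (q : EReal) ≤ s (i + 1) → x q = y q := by
          intro q h1 h2 h3 h4
          rcases le_or_gt q c with hqc | hqc
          · exact hagc q h1 hqc
          have hxq : ContinuousOn x (Icc (c - τ) q) :=
            hx.continuousOn_Icc (by linarith) (h2.trans_le (min_le_left _ _))
          have hyq : ContinuousOn y (Icc (c - τ) q) :=
            hy.continuousOn_Icc (by linarith) (h2.trans_le (min_le_right _ _))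
          -- At `q` itself an event is possible, so the held equations are compared on `[c, q)` only.
          have hIco : EqOn x y (Ico c q) := by
            intro p hp
            refine eqOn_of_heldEq hτ hf (u := k (x c)) (ht₀.trans hc0) hp.1
              (hxq.mono (Icc_subset_Icc le_rfl hp.2.le)) (hyq.mono (Icc_subset_Icc le_rfl hp.2.le))
              (fun v hv => hagc v (by linarith [hv.1]) hv.2) (fun v hv => ?_) (fun v hv => ?_)
            · have hvq : (v : EReal) < q := EReal.coe_lt_coe_iff.2 (hv.2.trans_lt hp.2)
              exact hx.dynamics i v (hc ▸ EReal.coe_le_coe_iff.2 hv.1) (hvq.trans_le h3)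
                ((hvq.trans h2).trans_le (min_le_left _ _))
            · have hvq : (v : EReal) < q := EReal.coe_lt_coe_iff.2 (hv.2.trans_lt hp.2)
              rw [hagc c (by linarith) le_rfl, ← hceq]
              exact hy.dynamics i v (hts ▸ hc ▸ EReal.coe_le_coe_iff.2 hv.1) (hvq.trans_le h4)
                ((hvq.trans h2).trans_le (min_le_right _ _))
          have hsub : Icc c q ⊆ Icc (c - τ) q := Icc_subset_Icc (by linarith) le_rfl
          exact hIco.of_subset_closure (hxq.mono hsub) (hyq.mono hsub) Ico_subset_Icc_self
            (closure_Ico hqc.ne).ge ⟨hqc.le, le_rfl⟩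
        refine ⟨fun h => ?_, hag⟩
        rcases le_total (t (i + 1)) (s (i + 1)) with hle | hle
        · have hlt : t (i + 1) < min T T' := h.elim id fun h => hle.trans_lt h
          refine le_antisymm hle (hx.succ_le_succ hy hτ hα hχ hσ ha hts hitop
            (hlt.trans_le (min_le_right _ _)) fun q h1 h2 => ?_)
          exact hag q (by linarith) (h2.trans_lt hlt) h2 (h2.trans hle)
        · have hlt : s (i + 1) < min T T' := h.elim (fun h => hle.trans_lt h) id
          refine le_antisymm (hy.succ_le_succ hx hτ hα hχ hσ ha hts.symm (hts ▸ hitop)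
            (hlt.trans_le (min_le_left _ _)) fun q h1 h2 => ?_) hle
          exact (hag q (by linarith) (h2.trans_lt hlt) (h2.trans hle) h2).symm
  rcases le_or_gt r t₀ with h0 | h0
  · exact hpast r hr h0
  · obtain ⟨i, -, hi⟩ := hx.cover r h0.le hrT
    have hrm : (r : EReal) < min T T' := lt_min hrT hrT'
    refine (key (i + 1)).2 r hr hrm hi.le ?_
    by_contra! hlt
    have := (key (i + 1)).1 (Or.inr (hlt.trans hrm))
    exact absurd hi (not_lt.2 (this.trans_le hlt.le))

/-- Solutions are bounded, hence have bounded velocity on bounded time intervals, while between two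
events the state moves at least by the threshold. So events do not accumulate. -/
theorem noZeno (hV : LyapunovConditions f k V₁ V₂ α₁ α₂ α₃ χ μ) (hτ : 0 ≤ τ)
    (hf_zero : ∀ t, 0 ≤ t → f t 0 0 = 0)
    (hσ : 0 ≤ σ) (hσμ : σ < μ) (ha : 0 < a) (hb : 0 ≤ b) (ht₀ : 0 ≤ t₀) (hk : Continuous k)
    (hf : LocLipField f) : NoZeno (IsClosedLoopSolution (τ := τ) f k α₁ χ σ a b t₀) := by
  intro φ T x t h S
  by_contra hinf
  have hall : ∀ i, t i ≤ S := by
    intro i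
    obtain ⟨j, hj, hij⟩ := Set.Infinite.exists_gt hinf i
    exact (h.monotone hij.le).trans hj
  have hfin : ∀ i, t i ≠ ⊤ := fun i => ne_top_of_le_ne_top (EReal.coe_ne_top S) (hall i)
  have hallS : ∀ i, (t i).toReal ≤ S := fun i => by
    rw [← EReal.coe_le_coe_iff, h.coe_toReal (hfin i)]
    exact hall i
  obtain ⟨R, hR, hbd⟩ := exists_norm_le hV hτ hσ hσμ ha hb ht₀ ‖φ‖
  have hxR := hbd φ T x t le_rfl h
  obtain ⟨K, hK⟩ := (isCompact_closedBall (0 : Vec n) R).exists_bound_of_continuousOn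
    hk.continuousOn
  obtain ⟨L, hL, hlin⟩ := hf.exists_linear_bound hf_zero S (max R K)
  refine not_forall_le_of_steps (s := fun i => (t i).toReal) (F := L * (R + K))
    (η := a * Real.exp (-b * (S - t₀))) (by positivity) (fun i => ?_) (fun i => ?_) hallS
  · simp only [h.event_zero, EReal.toReal_coe]
    exact h.le_toReal (hfin i)
  · obtain ⟨-, -, h3⟩ := h.event_spec hτ hV.classK_one hV.classK_chi hσ ha (hfin i)
    obtain ⟨r, hr1, hr2, hrT, hr4⟩ := h3 (hfin _)
    have hr : (t (i + 1)).toReal = r := by rw [hr1]; rfl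
    have hrS : r ≤ S := hr ▸ hallS (i + 1)
    have h0 := h.le_toReal (hfin i)
    have hlt : ∀ q ≤ r, (q : EReal) < T := fun q hq => (EReal.coe_le_coe_iff.2 hq).trans_lt hrT
    simp only [hr]
    refine le_trans ?_ ((threshold_le_of_event hV.classK_one hV.classK_chi hσ ha hr4).trans
      (h.norm_sub_le_of_event hτ (hfin i) hr1 hr2 hrT fun q hq => ?_))
    · gcongr ?_ * Real.exp ?_
      nlinarith
    · have h1 : ‖hist τ x q‖ ≤ R := norm_hist_le hR.le fun p hp =>
        hxR p (by linarith [hp.1, hq.1]) (hlt p (hp.2.trans hq.2))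
      have h2 : ‖k (x (t i).toReal)‖ ≤ K :=
        hK _ (mem_closedBall_zero_iff.2 (hxR _ (by linarith) (hlt _ hr2.le)))
      refine (hlin q (by linarith [hq.1]) (hq.2.trans hrS) _ _ (h1.trans (le_max_left _ _))
        (h2.trans (le_max_right _ _))).trans ?_
      exact mul_le_mul_of_nonneg_left (add_le_add h1 h2) hL.le

theorem tendsto_threshold {χ : ℝ → ℝ} (hχ : ClassK χ) (ha : 0 < a) (hb : 0 < b) (t₀ : ℝ) :
    Tendsto (fun s => χ (a * Real.exp (-b * (s - t₀)))) atTop (𝓝 0) := by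
  have h1 : Tendsto (fun s : ℝ => a * Real.exp (-b * (s - t₀))) atTop (𝓝 (a * 0)) := by
    refine (Real.tendsto_exp_atBot.comp ?_).const_mul a
    exact (tendsto_atTop_add_const_right _ (-t₀) tendsto_id).const_mul_atTop_of_neg (by linarith)
  rw [mul_zero] at h1
  have h2 : Tendsto (fun s : ℝ => a * Real.exp (-b * (s - t₀))) atTop (𝓝[Ici 0] 0) :=
    tendsto_nhdsWithin_iff.2 ⟨h1, Eventually.of_forall fun s => by
      rw [mem_Ici]; positivity⟩
  have h3 := hχ.continuousOn 0 (mem_Ici.2 le_rfl)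
  rw [ContinuousWithinAt, hχ.map_zero] at h3
  exact h3.comp h2

theorem IsClosedLoopSolution.attractive {φ : Hist τ n} {x : ℝ → Vec n} {t : ℕ → EReal}
    (h : IsClosedLoopSolution f k α₁ χ σ a b t₀ φ ⊤ x t)
    (hV : LyapunovConditions f k V₁ V₂ α₁ α₂ α₃ χ μ) (hτ : 0 ≤ τ) (hσ : 0 ≤ σ) (hσμ : σ < μ)
    (ha : 0 < a) (hb : 0 < b) (ht₀ : 0 ≤ t₀) : Tendsto x atTop (𝓝 0) := by
  rw [tendsto_zero_iff_norm_tendsto_zero, Metric.tendsto_atTop]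
  intro ε hε
  have hν : 0 < μ - σ := by linarith
  have hαε := hV.classK_one.toClassK.pos hε
  have hD : Tendsto (fun c => χ (a * Real.exp (-b * (c - t₀))) / (μ - σ)) atTop (𝓝 0) := by
    simpa using (tendsto_threshold hV.classK_chi ha hb t₀).div_const (μ - σ)
  obtain ⟨c, hcD, hc⟩ := ((hD.eventually_lt_const (half_pos hαε)).and
    (eventually_ge_atTop t₀)).exists
  have hw : Tendsto (fun s => Real.exp (-(μ - σ) * (s - c)) * lyap V₁ V₂ x c) atTop (𝓝 0) := by
    have h1 : Tendsto (fun s : ℝ => Real.exp (-(μ - σ) * (s - c))) atTop (𝓝 0) :=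
      Real.tendsto_exp_atBot.comp
        ((tendsto_atTop_add_const_right _ (-c) tendsto_id).const_mul_atTop_of_neg (by linarith))
    simpa using h1.mul_const (lyap V₁ V₂ x c)
  obtain ⟨S, hS⟩ := eventually_atTop.1 ((hw.eventually_lt_const (half_pos hαε)).and
    (eventually_ge_atTop c))
  refine ⟨S, fun s hs => ?_⟩
  obtain ⟨h1, hcs⟩ := hS s hs
  have h2 := h.decay hV hτ hσ hσμ ha hb.le ht₀ hc hcs (EReal.coe_lt_top s)
  have h3 := hV.le_lyap (x := x) (ht₀.trans (hc.trans hcs))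
  rw [dist_zero_right, norm_norm]
  by_contra! hle
  have := hV.classK_one.toClassK.mono hε.le hle
  linarith

end Main

/-! ### Stability -/

section Stability
variable {n m : ℕ} {τ : ℝ} {f : ℝ → Hist τ n → Vec m → Vec n} {k : Vec n → Vec m}
  {V₁ : ℝ → Vec n → ℝ} {V₂ : ℝ → Hist τ n → ℝ} {α₁ α₂ α₃ χ : ℝ → ℝ} {μ : ℝ} {σ a b t₀ : ℝ}

theorem exists_norm_le_mul_of_locallyLipschitz {E F : Type*} [NormedAddCommGroup E]
    [NormedAddCommGroup F] {k : E → F} (hk : LocallyLipschitz k) (h0 : k 0 = 0) :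
    ∃ K, 0 ≤ K ∧ ∃ δ, 0 < δ ∧ ∀ z, ‖z‖ < δ → ‖k z‖ ≤ K * ‖z‖ := by
  obtain ⟨K, s, hs, hK⟩ := hk 0
  obtain ⟨δ, hδ, hball⟩ := Metric.mem_nhds_iff.1 hs
  refine ⟨K, K.2, δ, hδ, fun z hz => ?_⟩
  have := hK.dist_le_mul z (hball (mem_ball_zero_iff.2 hz)) 0 (mem_of_mem_nhds hs)
  rwa [h0, dist_zero_right, dist_zero_right] at this

/-- Before the first event, the solution grows at most exponentially from the size of the initial
function. -/
theorem IsClosedLoopSolution.norm_le_exp {φ : Hist τ n} {T : EReal} {x : ℝ → Vec n}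
    {t : ℕ → EReal} (h : IsClosedLoopSolution f k α₁ χ σ a b t₀ φ T x t) (hτ : 0 ≤ τ)
    (ht₀ : 0 ≤ t₀) {L K R s : ℝ} (hL : 0 < L) (hK : 0 ≤ K)
    (hlin : ∀ t, 0 ≤ t → t ≤ s → ∀ (ψ : Hist τ n) (u : Vec m), ‖ψ‖ ≤ R → ‖u‖ ≤ R →
      ‖f t ψ u‖ ≤ L * (‖ψ‖ + ‖u‖))
    (hR : 0 ≤ R) (hxR : ∀ r, t₀ - τ ≤ r → (r : EReal) < T → ‖x r‖ ≤ R)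
    (hk : ‖k (x t₀)‖ ≤ K * ‖x t₀‖) (hkR : ‖k (x t₀)‖ ≤ R) (hs : t₀ ≤ s) (hsT : (s : EReal) < T)
    (hs1 : (s : EReal) < t 1) :
    ‖x s‖ ≤ 2 * ‖φ‖ * Real.exp (2 * (L * (1 + K)) * (s - t₀)) := by
  refine gronwall_bootstrap (d := fun q => ‖x q‖)
    (h.continuousOn_Icc (by linarith) hsT).norm (norm_nonneg φ) ?_ (by positivity) ⟨hs, le_rfl⟩
  intro P hP hb q hq
  have hltT : ∀ r ≤ s, (r : EReal) < T := fun r hr => (EReal.coe_le_coe_iff.2 hr).trans_lt hsT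
  have h0 : (t 0).toReal = t₀ := by rw [h.event_zero]; rfl
  have hP0 : 0 ≤ P := (norm_nonneg _).trans hP
  have hheld := h.dynamics 0 q (by rw [h.event_zero]; exact EReal.coe_le_coe_iff.2 hq.1)
    ((EReal.coe_le_coe_iff.2 hq.2).trans_lt hs1) (hltT q hq.2)
  rw [h0] at hheld
  have hx0 : ‖x t₀‖ ≤ ‖φ‖ := h.norm_le_of_le_start (by linarith) le_rfl
  have hint := norm_integral_le_exp_weight (N := fun r => f r (hist τ x r) (k (x t₀)))
    (K := L * (1 + K)) (P := P) hq.1 fun r hr => by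
      have hrs : r ≤ s := hr.2.trans hq.2
      have hexp : 1 ≤ Real.exp (2 * (L * (1 + K)) * (r - t₀)) :=
        Real.one_le_exp (mul_nonneg (by positivity) (by linarith [hr.1]))
      have hφ : ‖φ‖ ≤ P * Real.exp (2 * (L * (1 + K)) * (r - t₀)) :=
        hP.trans (le_mul_of_one_le_right hP0 hexp)
      have h1 : ‖hist τ x r‖ ≤ P * Real.exp (2 * (L * (1 + K)) * (r - t₀)) := by
        refine norm_hist_le (by positivity) fun p hp => ?_
        rcases le_total p t₀ with hp0 | hp0
        · exact (h.norm_le_of_le_start (by linarith [hp.1, hr.1]) hp0).trans hφ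
        · refine (hb p ⟨hp0, hp.2.trans hrs⟩).trans ?_
          have := hp.2
          gcongr
      have h2 : ‖k (x t₀)‖ ≤ K * (P * Real.exp (2 * (L * (1 + K)) * (r - t₀))) :=
        hk.trans (mul_le_mul_of_nonneg_left (hx0.trans hφ) hK)
      have h3 : ‖hist τ x r‖ ≤ R := norm_hist_le hR fun p hp =>
        hxR p (by linarith [hp.1, hr.1]) (hltT p (hp.2.trans hrs))
      refine (hlin r (by linarith [hr.1]) hrs _ _ h3 hkR).trans ?_
      rw [mul_assoc L]
      refine mul_le_mul_of_nonneg_left ?_ hL.le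
      linarith
  rw [hheld.2]
  refine (norm_add_le _ _).trans ?_
  linarith

/-- For small initial functions no event occurs until a time `S` after which the threshold is
negligible: until then the solution stays small by continuous dependence, from then on by decay. -/
theorem exists_delta_stable (hV : LyapunovConditions f k V₁ V₂ α₁ α₂ α₃ χ μ) (hτ : 0 ≤ τ)
    (hf_zero : ∀ t, 0 ≤ t → f t 0 0 = 0) (hk_zero : k 0 = 0)
    (hσ : 0 ≤ σ) (hσμ : σ < μ) (ha : 0 < a) (hb : 0 < b) (ht₀ : 0 ≤ t₀) (hk : LocallyLipschitz k)
    (hf : LocLipField f) {ε : ℝ} (hε : 0 < ε) :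
    ∃ δ, 0 < δ ∧ ∀ φ : Hist τ n, ‖φ‖ < δ → ∀ x t,
      IsClosedLoopSolution f k α₁ χ σ a b t₀ φ ⊤ x t → ∀ r, t₀ ≤ r → ‖x r‖ < ε := by
  have hαε := hV.classK_one.toClassK.pos hε
  have hD : Tendsto (fun c => χ (a * Real.exp (-b * (c - t₀))) / (μ - σ)) atTop (𝓝 0) := by
    simpa using (tendsto_threshold hV.classK_chi ha hb t₀).div_const (μ - σ)
  obtain ⟨S, hSD, hS⟩ := ((hD.eventually_lt_const (half_pos hαε)).and
    (eventually_ge_atTop t₀)).exists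
  -- The solution has to reach the size `θ / 2` in order to trigger an event before `S`.
  set θ := a * Real.exp (-b * (S - t₀)) with hθ
  have hθ0 : 0 < θ := by positivity
  obtain ⟨η, hη0, hηα, hηε, hηθ⟩ : ∃ η, 0 < η ∧ α₂ η + α₃ η < α₁ ε / 2 ∧ η < ε ∧ η < θ / 2 := by
    have h2 := hV.classK_two.toClassK.continuousOn 0 (mem_Ici.2 le_rfl)
    have h3 := hV.classK_three.toClassK.continuousOn 0 (mem_Ici.2 le_rfl)
    have h23 := h2.add h3
    rw [ContinuousWithinAt, Pi.add_apply, hV.classK_two.map_zero, hV.classK_three.map_zero,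
      add_zero] at h23
    have h4 := (h23.mono_left (nhdsWithin_mono 0 Ioi_subset_Ici_self)).eventually_lt_const
      (half_pos hαε)
    have h5 : ∀ᶠ η in 𝓝[>] (0 : ℝ), η ∈ Ioo 0 (min ε (θ / 2)) :=
      Ioo_mem_nhdsGT (lt_min hε (half_pos hθ0))
    obtain ⟨η, h6, h7⟩ := (h4.and h5).exists
    exact ⟨η, h7.1, h6, h7.2.trans_le (min_le_left _ _), h7.2.trans_le (min_le_right _ _)⟩
  obtain ⟨R, hR, hbd⟩ := exists_norm_le hV hτ hσ hσμ ha hb.le ht₀ 1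
  obtain ⟨K, hK, δ₁, hδ₁, hkK⟩ := exists_norm_le_mul_of_locallyLipschitz hk hk_zero
  obtain ⟨L, hL, hlin⟩ := hf.exists_linear_bound hf_zero S (max R K)
  set C := 2 * (L * (1 + K)) with hC
  have hC0 : 0 ≤ C := by positivity
  set A := 2 * Real.exp (C * (S - t₀)) with hA
  have hA2 : 2 ≤ A := by
    have : 1 ≤ Real.exp (C * (S - t₀)) := Real.one_le_exp (mul_nonneg hC0 (by linarith))
    linarith
  refine ⟨min (min 1 δ₁) (η / A), lt_min (lt_min one_pos hδ₁) (by positivity),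
    fun φ hφ x t h r hr => ?_⟩
  have hφ1 : ‖φ‖ < 1 := hφ.trans_le ((min_le_left _ _).trans (min_le_left _ _))
  have hφδ : ‖φ‖ < δ₁ := hφ.trans_le ((min_le_left _ _).trans (min_le_right _ _))
  have hφA : A * ‖φ‖ ≤ η := by
    have := hφ.trans_le (min_le_right _ _)
    rw [lt_div_iff₀ (by linarith)] at this
    linarith
  have hφη : ‖φ‖ ≤ η := by nlinarith [norm_nonneg φ]
  have hxR := hbd φ ⊤ x t hφ1.le h
  have hx0 : ‖x t₀‖ ≤ ‖φ‖ := h.norm_le_of_le_start (by linarith) le_rfl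
  have hk0 : ‖k (x t₀)‖ ≤ K * ‖x t₀‖ := hkK _ (hx0.trans_lt hφδ)
  have hkR : ‖k (x t₀)‖ ≤ max R K :=
    hk0.trans ((mul_le_of_le_one_right hK (hx0.trans hφ1.le)).trans (le_max_right _ _))
  have hsmall : ∀ s, t₀ ≤ s → s ≤ S → (s : EReal) < t 1 → ‖x s‖ ≤ η := by
    intro s hs hsS hs1
    refine (h.norm_le_exp hτ ht₀ hL hK (fun q h0 hq => hlin q h0 (hq.trans hsS))
      (hR.le.trans (le_max_left _ _)) (fun q h1 h2 => (hxR q h1 h2).trans (le_max_left _ _))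
      hk0 hkR hs (EReal.coe_lt_top s) hs1).trans (le_trans ?_ hφA)
    rw [hA, mul_right_comm]
    gcongr
  have ht0 : t 0 ≠ ⊤ := by rw [h.event_zero]; exact EReal.coe_ne_top t₀
  have ht0r : (t 0).toReal = t₀ := by rw [h.event_zero]; rfl
  have hS1 : (S : EReal) < t 1 := by
    by_contra! hle
    obtain ⟨-, -, h3⟩ := h.event_spec hτ hV.classK_one hV.classK_chi hσ ha ht0
    obtain ⟨p, hp1, hp2, hpT, hp4⟩ := h3 (ne_top_of_le_ne_top (EReal.coe_ne_top S) hle)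
    rw [zero_add] at hp1
    have hpS : p ≤ S := by rwa [hp1, EReal.coe_le_coe_iff] at hle
    rw [ht0r] at hp2 hp4
    have hcl : closure (Ico t₀ p) = Icc t₀ p := closure_Ico hp2.ne
    have hxp : ‖x p‖ ≤ η := by
      refine le_on_closure (s := Ico t₀ p) (f := fun q => ‖x q‖) (g := fun _ => η)
        (fun q hq => hsmall q hq.1 (hq.2.le.trans hpS) ?_) ?_ continuousOn_const
        (by rw [hcl]; exact ⟨hp2.le, le_rfl⟩)
      · rw [hp1]
        exact EReal.coe_lt_coe_iff.2 hq.2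
      · rw [hcl]
        exact (h.continuousOn_Icc (by linarith) hpT).norm
    have h5 := threshold_le_of_event hV.classK_one hV.classK_chi hσ ha hp4
    have h6 : θ ≤ a * Real.exp (-b * (p - t₀)) := by
      rw [hθ]
      gcongr ?_ * Real.exp ?_
      nlinarith
    have h7 := norm_sub_le (x t₀) (x p)
    linarith
  have hsmallS : ∀ s, t₀ ≤ s → s ≤ S → ‖x s‖ ≤ η := fun s h1 h2 =>
    hsmall s h1 h2 ((EReal.coe_le_coe_iff.2 h2).trans_lt hS1)
  rcases le_total r S with hrS | hrS
  · exact (hsmallS r hr hrS).trans_lt hηε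
  · have hS0 : 0 ≤ S := ht₀.trans hS
    have hlyap : lyap V₁ V₂ x S ≤ α₂ η + α₃ η := by
      refine hV.lyap_le hS0 (hsmallS S hS le_rfl) (norm_hist_le hη0.le fun q hq => ?_)
      rcases le_total q t₀ with hq0 | hq0
      · exact (h.norm_le_of_le_start (by linarith [hq.1]) hq0).trans hφη
      · exact hsmallS q hq0 hq.2
    have h0 : 0 ≤ lyap V₁ V₂ x S :=
      (hV.classK_one.toClassK.nonneg (norm_nonneg _)).trans (hV.le_lyap hS0)
    have hexp : Real.exp (-(μ - σ) * (r - S)) ≤ 1 := by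
      rw [Real.exp_le_one_iff]
      nlinarith
    have h1 := h.decay hV hτ hσ hσμ ha hb.le ht₀ hS hrS (EReal.coe_lt_top r)
    have h2 := hV.le_lyap (x := x) (ht₀.trans hr)
    have h3 := mul_le_of_le_one_left h0 hexp
    by_contra! hle
    have := hV.classK_one.toClassK.mono hε.le hle
    linarith

end Stability
end DelayETC

theorem theorem1 {n m : ℕ} {τ : ℝ} (hτ : 0 < τ)
    (f : ℝ → DelayETC.Hist τ n → DelayETC.Vec m → DelayETC.Vec n)
    (k : DelayETC.Vec n → DelayETC.Vec m)
    (hf_zero : ∀ t, 0 ≤ t → f t 0 0 = 0) (hk_zero : k 0 = 0)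
    (hf_meas : ∀ φ u, Measurable fun t : ℝ≥0 => f t φ u)
    (V₁ : ℝ → DelayETC.Vec n → ℝ) (V₂ : ℝ → DelayETC.Hist τ n → ℝ)
    (α₁ α₂ α₃ χ : ℝ → ℝ) (μ : ℝ)
    (hV : DelayETC.LyapunovConditions f k V₁ V₂ α₁ α₂ α₃ χ μ)
    (σ a b : ℝ) (hσ : 0 ≤ σ) (hσμ : σ < μ) (ha : 0 < a) (hb : 0 < b)
    (hα₁ : LocallyLipschitzOn (Ici 0) (DelayETC.invK α₁))
    (hχ : LocallyLipschitzOn (Ici 0) χ)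
    (hk : LocallyLipschitz k)
    (hf : DelayETC.LocLipField f)
    (t₀ : ℝ) (ht₀ : 0 ≤ t₀) :
    DelayETC.GloballyAsymptoticallyStable t₀
        (DelayETC.IsClosedLoopSolution f k α₁ χ σ a b t₀) ∧
      DelayETC.NoZeno (DelayETC.IsClosedLoopSolution f k α₁ χ σ a b t₀) := by
  refine ⟨⟨fun φ => ?_, fun ε hε => ?_, fun φ x t h => ?_⟩,
    DelayETC.noZeno hV hτ.le hf_zero hσ hσμ ha hb.le ht₀ hk.continuous hf⟩
  · obtain ⟨x, t, h⟩ := DelayETC.exists_global_solution hV hτ.le hf_zero hf_meas hσ hσμ ha hb.le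
      ht₀ hk.continuous hf φ
    exact ⟨x, t, h, fun T y s hy r hr hrT => hy.unique h hτ.le hV.classK_one hV.classK_chi hσ ha
      ht₀ hf hr hrT (EReal.coe_lt_top r)⟩
  · exact DelayETC.exists_delta_stable hV hτ.le hf_zero hk_zero hσ hσμ ha hb ht₀ hk hf hε
  · exact h.attractive hV hτ.le hσ hσμ ha hb ht₀
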